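/- **Hill–Kertz constants.** For $n\ge 2$ and $w,x\ge 0$ put $\phi_n(w,x)=\frac{n}{n-1}w^{(n-1)/n}+\frac{x}{n-1}$, and for $\alpha\ge 0$ define $\eta_{0,n}(\alpha)=\phi_n(0,\alpha)$ and $\eta_{j,n}(\alpha)=\phi_n(\eta_{j-1,n}(\alpha),\alpha)$ for $j\ge 1$. For each $n\ge 2$ there is a unique $\beta_n\in(0,1)$ with $(n-1)\left[\eta_{n,n}(\beta_n)-\eta_{n-1,n}(\beta_n)\right]=1$; put $b_n:=\beta_n$. **Setting.** Let $X_1,X_2,\dots$ be i.i.d. $[0,1]$-valued random variables, and let $S_1,S_2,\dots$ be the successive arrival times of a Poisson process with unit rate (that is, $S_1,\,S_2-S_1,\,S_3-S_2,\dots$ are independent and exponentially distributed with mean $1$), with the sequence $(S_k)$ independent of the sequence $(X_k)$. For $t>0$ let $$M(t)=\mathrm E\Big[\max_{k\ge 1}X_k\,\mathbf 1(S_k\le t)\Big],\qquad V(t)=\sup_{\tau}\mathrm E\big[X_\tau\,\mathbf 1(S_\tau\le t)\big],$$ where the supremum is over all $\{1,2,\dots\}$-valued random variables $\tau$ such that,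 for every $i$, the event $\{\tau=i\}$ belongs to the $\sigma$-algebra generated by $(X_1,S_1),\dots,(X_i,S_i)$. **Theorem.** For every $t>0$, $$M(t)-V(t)\le\limsup_{n\to\infty}b_n,$$ and, more precisely, for every $t>0$ and every $n\ge 2$, $$M(t)-V(t)\le b_n+(1-e^{-t})\left[1-\frac{n(1-e^{-t/n})}{t}\right].$$ -/

import Mathlib

open MeasureTheory ProbabilityTheory Filter

noncomputable section

/-- The Hill-Kertz function `φ_n(w, x) = (n / (n - 1)) w ^ ((n - 1) / n) + x / (n - 1)`. -/
def hillKertzPhi (n : ℕ) (w x : ℝ) : ℝ :=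
  ((n : ℝ) / ((n : ℝ) - 1)) * w ^ (((n : ℝ) - 1) / (n : ℝ)) + x / ((n : ℝ) - 1)

/-- `η_{0,n}(α) = φ_n(0, α)` and `η_{j+1,n}(α) = φ_n(η_{j,n}(α), α)`. The arguments are `n j α`. -/
def hillKertzEta (n : ℕ) : ℕ → ℝ → ℝ
  | 0, α => hillKertzPhi n 0 α
  | j + 1, α => hillKertzPhi n (hillKertzEta n j α) α

/-- `β ∈ (0, 1)` solves `(n - 1) [η_{n,n}(β) - η_{n-1,n}(β)] = 1` (meant for `n ≥ 2`). -/
def IsHillKertzBeta (n : ℕ) (β : ℝ) : Prop :=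
  β ∈ Set.Ioo (0 : ℝ) 1 ∧
    ((n : ℝ) - 1) * (hillKertzEta n n β - hillKertzEta n (n - 1) β) = 1

/-- The Hill-Kertz difference constant `b_n = β_n`: the solution of the defining equation. -/
def hillKertzB (n : ℕ) : ℝ := Classical.epsilon (IsHillKertzBeta n)

variable {Ω : Type*} [MeasurableSpace Ω]

/-- The waiting times between arrivals. Sequences are indexed from `0`, so `S k` is the
`(k+1)`-st arrival time and the process starts at time `0`. -/
def interarrival (S : ℕ → Ω → ℝ) : ℕ → Ω → ℝ
  | 0 => S 0
  | k + 1 => fun ω => S (k + 1) ω - S k ω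

/-- `S 0, S 1, …` are the successive arrival times of a Poisson process with unit rate:
the interarrival times are independent and exponentially distributed with parameter `1`. -/
structure IsUnitPoissonArrivals (S : ℕ → Ω → ℝ) (P : Measure Ω) : Prop where
  measurable : ∀ k, Measurable (S k)
  indep : iIndepFun (interarrival S) P
  law : ∀ k, P.map (interarrival S k) = expMeasure 1

/-- The σ-algebra generated by the pairs `(X 0, S 0), …, (X i, S i)`. -/
abbrev observedSigma (X S : ℕ → Ω → ℝ) (i : ℕ) : MeasurableSpace Ω :=
  ⨆ j ∈ Finset.range (i + 1),
    MeasurableSpace.comap (fun ω => (X j ω, S j ω)) inferInstance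

/-- The everywhere finite stopping rules: `{τ = i}` is determined by the first observations,
up to and including the one with index `i`. -/
def IsStoppingRule (X S : ℕ → Ω → ℝ) (τ : Ω → ℕ) : Prop :=
  ∀ i, MeasurableSet[observedSigma X S i] {ω | τ ω = i}

/-- `X_k I(S_k ≤ t)`. -/
def payoff (X S : ℕ → Ω → ℝ) (t : ℝ) (k : ℕ) (ω : Ω) : ℝ :=
  if S k ω ≤ t then X k ω else 0

/-- The value of the prophet, `M(t) = E[max_k X_k I(S_k ≤ t)]`. -/
def prophetValue (X S : ℕ → Ω → ℝ) (P : Measure Ω) (t : ℝ) : ℝ :=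
  ∫ ω, ⨆ k, payoff X S t k ω ∂P

/-- The optimal stopping value, `V(t) = sup_τ E[X_τ I(S_τ ≤ t)]`. -/
def stoppingValue (X S : ℕ → Ω → ℝ) (P : Measure Ω) (t : ℝ) : ℝ :=
  sSup {v : ℝ | ∃ τ : Ω → ℕ, IsStoppingRule X S τ ∧ v = ∫ ω, payoff X S t (τ ω) ω ∂P}

end

set_option linter.unusedSectionVars false

section MarkedPoisson

variable {Ω : Type*} [MeasurableSpace Ω]

/-! ### The Hill-Kertz constants -/

/-! Cut `[0, t]` into `n` intervals of length `t / n`. A stopper who sees only the first arrival in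
each interval faces `n` i.i.d. variables, each equal to a mark with probability `q = 1 - e^(-t/n)`
and to `0` otherwise, hence with tail `G(x) = q p(x)`, where `p(x)` is the tail of a mark. Three
comparisons then give the bound.

Prophet: the Poisson maximum exceeds `x` with probability at most `1 - e^(-t p(x))`
(`prophetValue_le`), while the discrete maximum exceeds it with probability `1 - (1 - q p(x))^n`.
`one_sub_pow_sub_exp_le` bounds the difference by the stated error term, uniformly in `p`.

Discrete problem: `hillKertz_inequality` bounds the expected maximum by the discrete optimal value
`v n` plus `β_n`. The function `x^n` is bounded below by a different tangent line on each `[v j, v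
(j+1)]` and on `[v (n-1), 1]`. The recursion for `η` chooses the tangents so that the integrated
bounds telescope, and the equation for `β_n` closes the sum.

Stopper: `v n` is at most the Poisson value. No discrete rule is simulated. The value `w(s)` with
time `s` left, a limit of finite-horizon values, satisfies `w(s + d) ≥ e^(-d) w(s) + (1 - e^(-d)) E
max(X, w(s))`, the recursion for `v` with `≥` in place of `=` (`valueIteration_add_ge`). The
finite-horizon values are attained by threshold rules (`exists_stoppingRule`).

The `limsup` bound follows since the error term tends to `0`. -/

lemma hillKertz_exponent {n : ℕ} (hn : 2 ≤ n) :
    (2 : ℝ) ≤ n ∧ 0 < ((n : ℝ) - 1) / n ∧ ((n : ℝ) - 1) / n < 1 := by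
  have h : (2 : ℝ) ≤ n := by exact_mod_cast hn
  refine ⟨h, div_pos (by linarith) (by linarith), ?_⟩
  rw [div_lt_one (by linarith)]
  linarith

lemma rpow_le_one_add_mul {w e : ℝ} (hw : 0 ≤ w) (he : 0 ≤ e) (he1 : e ≤ 1) :
    w ^ e ≤ 1 + e * (w - 1) := by
  have := rpow_one_add_le_one_add_mul_self (s := w - 1) (by linarith) he he1
  simpa using this

/-- The profile `n w ^ ((n - 1) / n) - (n - 1) w`, which is `(n - 1) (φ_n(w, α) - w) - α`. -/
noncomputable def hillKertzGap (n : ℕ) (w : ℝ) : ℝ :=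
  (n : ℝ) * w ^ (((n : ℝ) - 1) / (n : ℝ)) - ((n : ℝ) - 1) * w

lemma hillKertzPhi_sub {n : ℕ} (hn : 2 ≤ n) (w α : ℝ) :
    ((n : ℝ) - 1) * (hillKertzPhi n w α - w) = hillKertzGap n w + α := by
  obtain ⟨h2, -, -⟩ := hillKertz_exponent hn
  have : (n : ℝ) - 1 ≠ 0 := by linarith
  unfold hillKertzPhi hillKertzGap
  field_simp
  ring

lemma hillKertzEta_sub {n : ℕ} (hn : 2 ≤ n) (α : ℝ) :
    ((n : ℝ) - 1) * (hillKertzEta n n α - hillKertzEta n (n - 1) α) =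
      hillKertzGap n (hillKertzEta n (n - 1) α) + α := by
  obtain ⟨m, rfl⟩ : ∃ m, n = m + 1 := ⟨n - 1, by omega⟩
  rw [← hillKertzPhi_sub hn]
  rfl

lemma hillKertzGap_le_one {n : ℕ} (hn : 2 ≤ n) {w : ℝ} (hw : 0 ≤ w) : hillKertzGap n w ≤ 1 := by
  obtain ⟨h2, he, he1⟩ := hillKertz_exponent hn
  have h := mul_le_mul_of_nonneg_left (rpow_le_one_add_mul hw he.le he1.le)
    (show (0 : ℝ) ≤ n by linarith)
  have h3 : (n : ℝ) * (1 + ((n : ℝ) - 1) / n * (w - 1)) = n + (n - 1) * (w - 1) := by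
    field_simp
  unfold hillKertzGap
  linarith

/-- Concavity of the power at ratio `u / w` gives `n (w^e - u^e) ≥ (n - 1) (1 - u/w) w^e` with `e =
(n - 1)/n`. Since `w ≤ 1`, `w^e ≥ w`, and the right side is at least `(n - 1)(w - u)`. -/
lemma hillKertzGap_mono {n : ℕ} (hn : 2 ≤ n) {u w : ℝ} (hu : 0 ≤ u) (huw : u ≤ w) (hw : w ≤ 1) :
    hillKertzGap n u ≤ hillKertzGap n w := by
  obtain ⟨h2, he, he1⟩ := hillKertz_exponent hn
  rcases (hu.trans huw).eq_or_lt with h0 | h0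
  · rw [le_antisymm (huw.trans h0.ge) hu, h0]
  have h := rpow_le_one_add_mul (div_nonneg hu h0.le) he.le he1.le
  rw [Real.div_rpow hu h0.le, div_le_iff₀ (Real.rpow_pos_of_pos h0 _)] at h
  have hwe : w ≤ w ^ (((n : ℝ) - 1) / n) := by
    simpa using Real.rpow_le_rpow_of_exponent_ge h0 hw he1.le
  have h4 : (1 - u / w) * w ≤ (1 - u / w) * w ^ (((n : ℝ) - 1) / n) :=
    mul_le_mul_of_nonneg_left hwe (by rw [sub_nonneg, div_le_one h0]; exact huw)
  have h5 : (1 - u / w) * w = w - u := by field_simp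
  have h6 : (n : ℝ) * (((n : ℝ) - 1) / n) = n - 1 := by field_simp
  have h7 := mul_le_mul_of_nonneg_left h (show (0 : ℝ) ≤ n by linarith)
  have h8 := mul_le_mul_of_nonneg_left h4 (show (0 : ℝ) ≤ (n : ℝ) - 1 by linarith)
  rw [h5] at h8
  have h9 : (n : ℝ) * ((1 + ((n : ℝ) - 1) / n * (u / w - 1)) * w ^ (((n : ℝ) - 1) / n)) =
      n * w ^ (((n : ℝ) - 1) / n) -
        (n * (((n : ℝ) - 1) / n)) * ((1 - u / w) * w ^ (((n : ℝ) - 1) / n)) := by ring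
  rw [h9, h6] at h7
  unfold hillKertzGap
  linarith

/-- Beyond `w = 1` the gap falls below its maximum `1`, but by less than `α` in the range that
`hillKertzEta_le` allows for `η_{n-1}`. -/
lemma one_lt_hillKertzGap_add {n : ℕ} (hn : 2 ≤ n) {w α : ℝ} (hα : 0 < α) (hα1 : α ≤ 1)
    (hw : 1 ≤ w) (hw' : w ≤ 1 + n * α / (n - 1)) : 1 < hillKertzGap n w + α := by
  obtain ⟨h2, he, he1⟩ := hillKertz_exponent hn
  have hn1 : (0 : ℝ) < n - 1 := by linarith
  -- With `e = (n - 1)/n` this is `w = 1 + a/e`. The bound `w^e > 1 + e a` makes the gap exceed `1 -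
  -- a ≥ 1 - α`.
  obtain ⟨a, ha⟩ : ∃ a, a = (w - 1) * (n - 1) / n := ⟨_, rfl⟩
  have hwa : w = 1 + n * a / (n - 1) := by rw [ha]; field_simp; ring
  have ha0 : 0 ≤ a := by rw [ha]; exact div_nonneg (mul_nonneg (by linarith) hn1.le) (by linarith)
  have haα : a ≤ α := by
    rw [hwa] at hw'
    have : n * a / (n - 1) ≤ n * α / ((n : ℝ) - 1) := by linarith
    rw [div_le_div_iff_of_pos_right hn1] at this
    exact le_of_mul_le_mul_left this (by linarith)
  rcases ha0.eq_or_lt with h0 | h0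
  · rw [← h0] at hwa
    simp only [mul_zero, zero_div, add_zero] at hwa
    subst hwa
    unfold hillKertzGap
    rw [Real.one_rpow]
    linarith
  have hc : (1 : ℝ) + ((n : ℝ) - 1) / n * a < w ^ (((n : ℝ) - 1) / n) := by
    set e := ((n : ℝ) - 1) / n with hedef
    have he2 : 1 / 2 ≤ e := by
      rw [hedef, div_le_div_iff₀ (by norm_num) (by linarith)]; linarith
    have hbase : 0 < 1 + e * a := by positivity
    -- As `1 < 1/e ≤ 2`, one factor `1 + e a` is split off and Bernoulli's inequality applies to the
    -- remaining exponent `1/e - 1` in `[0, 1]`.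
    have hkey : (1 + e * a) ^ (1 / e) < w := by
      have h1 : (1 + e * a) ^ (1 / e) = (1 + e * a) * (1 + e * a) ^ (1 / e - 1) := by
        rw [Real.rpow_sub_one hbase.ne']
        field_simp
      have hinv : 1 < 1 / e := by rw [lt_div_iff₀ he]; linarith
      have hinv2 : 1 / e ≤ 2 := by rw [div_le_iff₀ he]; linarith
      have h3 : (1 + e * a) ^ (1 / e - 1) ≤ 1 + (1 / e - 1) * (e * a) := by
        have := rpow_le_one_add_mul (w := 1 + e * a) hbase.le
          (show 0 ≤ 1 / e - 1 by linarith) (by linarith)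
        simpa using this
      have h4 : w = 1 + a / e := by
        rw [hwa, hedef]; field_simp
      rw [h1, h4]
      refine (mul_le_mul_of_nonneg_left h3 hbase.le).trans_lt ?_
      have h5 : (1 + e * a) * (1 + (1 / e - 1) * (e * a)) = 1 + a + (1 - e) * e * a * a := by
        field_simp; ring
      have h6 : a / e = a + (1 - e) * a * (1 / e) := by field_simp; ring
      rw [h5, h6]
      have h7 : 0 < (1 - e) * a := mul_pos (by linarith) h0
      have h8 : e * a < 1 / e := by nlinarith
      nlinarith [mul_lt_mul_of_pos_left h8 h7]
    have h9 := Real.rpow_lt_rpow (by positivity) hkey he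
    rwa [← Real.rpow_mul hbase.le, one_div_mul_cancel he.ne', Real.rpow_one] at h9
  have h10 := mul_lt_mul_of_pos_left hc (show (0 : ℝ) < n by linarith)
  have h11 : (n : ℝ) * (1 + ((n : ℝ) - 1) / n * a) = n + (n - 1) * a := by field_simp
  have h12 : ((n : ℝ) - 1) * w = n - 1 + n * a := by rw [hwa]; field_simp
  unfold hillKertzGap
  linarith

lemma hillKertzPhi_nonneg {n : ℕ} (hn : 2 ≤ n) {w α : ℝ} (hw : 0 ≤ w) (hα : 0 ≤ α) :
    0 ≤ hillKertzPhi n w α := by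
  obtain ⟨h2, he, he1⟩ := hillKertz_exponent hn
  have hn1 : (0 : ℝ) < n - 1 := by linarith
  unfold hillKertzPhi
  positivity

lemma hillKertzEta_nonneg {n : ℕ} (hn : 2 ≤ n) {α : ℝ} (hα : 0 ≤ α) (j : ℕ) :
    0 ≤ hillKertzEta n j α := by
  induction j with
  | zero => exact hillKertzPhi_nonneg hn le_rfl hα
  | succ j ih => exact hillKertzPhi_nonneg hn ih hα

lemma hillKertzPhi_mono {n : ℕ} (hn : 2 ≤ n) {w w' α α' : ℝ} (hw : 0 ≤ w) (hww : w ≤ w')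
    (hα : α ≤ α') : hillKertzPhi n w α ≤ hillKertzPhi n w' α' := by
  obtain ⟨h2, he, he1⟩ := hillKertz_exponent hn
  have hn1 : (0 : ℝ) < n - 1 := by linarith
  unfold hillKertzPhi
  gcongr

lemma hillKertzEta_mono {n : ℕ} (hn : 2 ≤ n) {α α' : ℝ} (hα : 0 ≤ α) (hαα : α ≤ α') (j : ℕ) :
    hillKertzEta n j α ≤ hillKertzEta n j α' := by
  induction j with
  | zero => exact hillKertzPhi_mono hn le_rfl le_rfl hαα
  | succ j ih => exact hillKertzPhi_mono hn (hillKertzEta_nonneg hn hα j) ih hαα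

lemma continuous_hillKertzEta {n : ℕ} (hn : 2 ≤ n) (j : ℕ) :
    Continuous fun α => hillKertzEta n j α := by
  obtain ⟨h2, he, he1⟩ := hillKertz_exponent hn
  induction j with
  | zero => simp only [hillKertzEta, hillKertzPhi]; fun_prop
  | succ j ih =>
    simp only [hillKertzEta, hillKertzPhi]
    have := (Real.continuous_rpow_const he.le).comp ih
    simp only [Function.comp_def] at this
    fun_prop

lemma hillKertzEta_le {n : ℕ} (hn : 2 ≤ n) {α : ℝ} (hα : 0 ≤ α) (j : ℕ) :
    ((n : ℝ) - 1) * hillKertzEta n j α ≤ α + j * (1 + α) := by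
  obtain ⟨h2, he, he1⟩ := hillKertz_exponent hn
  induction j with
  | zero =>
    have := hillKertzPhi_sub hn 0 α
    simp only [hillKertzGap, Real.zero_rpow he.ne'] at this
    simp only [hillKertzEta]
    push_cast
    linarith
  | succ j ih =>
    have := hillKertzPhi_sub hn (hillKertzEta n j α) α
    have h' := hillKertzGap_le_one hn (hillKertzEta_nonneg hn hα j)
    simp only [hillKertzEta]
    push_cast
    linarith

lemma one_lt_of_one_le_hillKertzEta {n : ℕ} (hn : 2 ≤ n) {α : ℝ} (hα : 0 < α) (hα1 : α ≤ 1)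
    (h : 1 ≤ hillKertzEta n (n - 1) α) :
    1 < ((n : ℝ) - 1) * (hillKertzEta n n α - hillKertzEta n (n - 1) α) := by
  obtain ⟨h2, he, he1⟩ := hillKertz_exponent hn
  have hn1 : (0 : ℝ) < n - 1 := by linarith
  rw [hillKertzEta_sub hn]
  refine one_lt_hillKertzGap_add hn hα hα1 h ?_
  have h3 := hillKertzEta_le hn hα.le (n - 1)
  rw [Nat.cast_sub (by omega), Nat.cast_one] at h3
  have h4 : 1 + n * α / (n - 1) = (α + ((n : ℝ) - 1) * (1 + α)) / (n - 1) := by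
    field_simp; ring
  rw [h4, le_div_iff₀ hn1]
  linarith

/-- The defining expression is `gap(η_{n-1}(α)) + α`. At a root `η_{n-1} < 1`, and there the gap is
monotone, so the expression is strictly increasing up to the larger root. -/
theorem isHillKertzBeta_unique {n : ℕ} (hn : 2 ≤ n) {α β : ℝ} (hα : IsHillKertzBeta n α)
    (hβ : IsHillKertzBeta n β) : α = β := by
  wlog hlt : α < β generalizing α β
  · rcases lt_trichotomy α β with h | h | h
    · exact this hα hβ h
    · exact h
    · exact (this hβ hα h).symm
  obtain ⟨⟨ha0, ha1⟩, ha⟩ := hα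
  obtain ⟨⟨hb0, hb1⟩, hb⟩ := hβ
  have hle : hillKertzEta n (n - 1) β < 1 := by
    by_contra! h
    exact absurd hb (one_lt_of_one_le_hillKertzEta hn hb0 hb1.le h).ne'
  rw [hillKertzEta_sub hn] at ha hb
  have := hillKertzGap_mono hn (hillKertzEta_nonneg hn ha0.le (n - 1))
    (hillKertzEta_mono hn ha0.le hlt.le (n - 1)) hle.le
  linarith

theorem exists_isHillKertzBeta {n : ℕ} (hn : 2 ≤ n) : ∃ β, IsHillKertzBeta n β := by
  obtain ⟨h2, he, he1⟩ := hillKertz_exponent hn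
  have hn1 : (0 : ℝ) < n - 1 := by linarith
  set F : ℝ → ℝ := fun α => ((n : ℝ) - 1) * (hillKertzEta n n α - hillKertzEta n (n - 1) α)
    with hF
  have hcont : Continuous F := by
    have h3 := continuous_hillKertzEta hn n
    have h4 := continuous_hillKertzEta hn (n - 1)
    fun_prop
  have hzero : ∀ j, hillKertzEta n j 0 = 0 := by
    intro j
    induction j with
    | zero => simp [hillKertzEta, hillKertzPhi, Real.zero_rpow he.ne']
    | succ j ih => simp [hillKertzEta, hillKertzPhi, ih, Real.zero_rpow he.ne']
  have hF0 : F 0 = 0 := by simp [hF, hzero]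
  have hF1 : 1 < F 1 := by
    rcases le_total 1 (hillKertzEta n (n - 1) 1) with h | h
    · exact one_lt_of_one_le_hillKertzEta hn one_pos le_rfl h
    · have hpos : 0 < hillKertzEta n (n - 1) 1 := by
        have hphi : ∀ w, 0 ≤ w → 0 < hillKertzPhi n w 1 := by
          intro w hw
          unfold hillKertzPhi
          positivity
        cases h : n - 1 with
        | zero => exact hphi 0 le_rfl
        | succ j => exact hphi _ (hillKertzEta_nonneg hn zero_le_one j)
      have hge : hillKertzEta n (n - 1) 1 ≤ hillKertzEta n (n - 1) 1 ^ (((n : ℝ) - 1) / n) := by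
        simpa using Real.rpow_le_rpow_of_exponent_ge hpos h he1.le
      simp only [hF]
      rw [hillKertzEta_sub hn]
      unfold hillKertzGap
      have := mul_le_mul_of_nonneg_left hge (show (0 : ℝ) ≤ n by linarith)
      linarith
  obtain ⟨β, ⟨hβ0, hβ1⟩, hβ⟩ := intermediate_value_Ioo zero_le_one hcont.continuousOn
    (show (1 : ℝ) ∈ Set.Ioo (F 0) (F 1) from ⟨by rw [hF0]; exact one_pos, hF1⟩)
  exact ⟨β, ⟨hβ0, hβ1⟩, hβ⟩

theorem isHillKertzBeta_hillKertzB {n : ℕ} (hn : 2 ≤ n) : IsHillKertzBeta n (hillKertzB n) :=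
  Classical.epsilon_spec (exists_isHillKertzBeta hn)

/-! ### The prophet inequality for independent identically distributed variables -/

/-- The left side is the tangent line of the convex function `x^n` at `x = y^(1/n)`. It follows from
weighted AM-GM. -/
lemma hillKertz_tangent {n : ℕ} (hn : 2 ≤ n) {x y : ℝ} (hx : 0 ≤ x) (hy : 0 ≤ y) :
    (n : ℝ) * y ^ (((n : ℝ) - 1) / n) * x - ((n : ℝ) - 1) * y ≤ x ^ n := by
  obtain ⟨h2, he, he1⟩ := hillKertz_exponent hn
  have h := Real.geom_mean_le_arith_mean2_weighted (w₁ := (n : ℝ)⁻¹) (w₂ := ((n : ℝ) - 1) / n)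
    (p₁ := x ^ n) (p₂ := y) (by positivity) he.le (by positivity) hy (by field_simp; ring)
  rw [Real.pow_rpow_inv_natCast hx (by omega)] at h
  have h3 := mul_le_mul_of_nonneg_left h (show (0 : ℝ) ≤ n by linarith)
  have h4 : (n : ℝ) * ((n : ℝ)⁻¹ * x ^ n + ((n : ℝ) - 1) / n * y) = x ^ n + (n - 1) * y := by
    field_simp
  rw [h4] at h3
  linarith

/-! ### Stopping values for a common survival function -/

section

variable {G : ℝ → ℝ}

lemma Antitone.intervalIntegrable_one_sub_pow (hG : Antitone G) (hG1 : ∀ x, G x ≤ 1) (n : ℕ)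
    (a b : ℝ) : IntervalIntegrable (fun x => (1 - G x) ^ n) volume a b := by
  refine Monotone.intervalIntegrable fun x y hxy => ?_
  have h1 := hG hxy
  have h2 := hG1 x
  exact pow_le_pow_left₀ (by linarith) (by linarith) n

lemma hillKertz_tangent_integral {n : ℕ} (hn : 2 ≤ n) (hG : Antitone G) (hG1 : ∀ x, G x ≤ 1)
    {y a b : ℝ} (hy : 0 ≤ y) (hab : a ≤ b) :
    (n : ℝ) * y ^ (((n : ℝ) - 1) / n) * (b - a - ∫ x in a..b, G x) - ((n : ℝ) - 1) * y * (b - a)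
      ≤ ∫ x in a..b, (1 - G x) ^ n := by
  have hGi : IntervalIntegrable G volume a b := hG.intervalIntegrable
  have h1 : ∫ x in a..b, ((n : ℝ) * y ^ (((n : ℝ) - 1) / n) * (1 - G x) - ((n : ℝ) - 1) * y) =
      (n : ℝ) * y ^ (((n : ℝ) - 1) / n) * (b - a - ∫ x in a..b, G x) -
        ((n : ℝ) - 1) * y * (b - a) := by
    rw [intervalIntegral.integral_sub, intervalIntegral.integral_const_mul,
      intervalIntegral.integral_sub, intervalIntegral.integral_const,
      intervalIntegral.integral_const]
    · simp only [smul_eq_mul]; ring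
    · simp
    · exact hGi
    · exact (IntervalIntegrable.sub (by simp) hGi).const_mul _
    · simp
  rw [← h1]
  refine intervalIntegral.integral_mono_on hab ?_
    (hG.intervalIntegrable_one_sub_pow hG1 n a b) fun x _ => ?_
  · exact ((IntervalIntegrable.sub (by simp) hGi).const_mul _).sub (by simp)
  · exact hillKertz_tangent hn (by linarith [hG1 x]) hy

variable {v : ℕ → ℝ}

lemma stopValue_mem_Icc (hG : Antitone G) (hG0 : ∀ x, 0 ≤ G x) (hG1 : ∀ x, G x ≤ 1)
    (hv0 : v 0 = 0) (hv : ∀ j, v (j + 1) = v j + ∫ x in v j..1, G x) (j : ℕ) :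
    0 ≤ v j ∧ v j ≤ v (j + 1) ∧ v j ≤ 1 := by
  have key : ∀ j, v j ≤ 1 → v j ≤ v (j + 1) ∧ v (j + 1) ≤ 1 := by
    intro j hj
    rw [hv]
    have h1 := intervalIntegral.integral_nonneg (f := G) (μ := volume) hj fun x _ => hG0 x
    have h2 := intervalIntegral.integral_mono_on (f := G) (g := fun _ => (1 : ℝ)) (μ := volume) hj
      hG.intervalIntegrable (by simp) fun x _ => hG1 x
    rw [intervalIntegral.integral_const, smul_eq_mul] at h2
    constructor <;> linarith
  induction j with
  | zero => rw [hv0]; exact ⟨le_rfl, hv0 ▸ (key 0 (by simp [hv0])).1, zero_le_one⟩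
  | succ j ih =>
    obtain ⟨h0, h1, h2⟩ := ih
    exact ⟨h0.trans h1, (key _ (key j h2).2).1, (key j h2).2⟩

/-- Adding the tangent bound with parameter `η_j` on `[v j, v (j+1)]` passes from `j` to `j + 1`:
the terms in `(n - 1) η_j` cancel, and the slope multiplies `v (j+2) - v (j+1)`, because the
recursion for `v` turns the integral of `1 - G` into the next increment. -/
lemma hillKertz_partial {n : ℕ} (hn : 2 ≤ n) {β : ℝ} (hβ : 0 ≤ β) (hG : Antitone G)
    (hG0 : ∀ x, 0 ≤ G x) (hG1 : ∀ x, G x ≤ 1)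
    (hv0 : v 0 = 0) (hv : ∀ j, v (j + 1) = v j + ∫ x in v j..1, G x) (j : ℕ) :
    (((n : ℝ) - 1) * hillKertzEta n j β - β) * (v (j + 1) - v j) - β * v j
      ≤ ∫ x in 0..v j, (1 - G x) ^ n := by
  obtain ⟨h2, he, he1⟩ := hillKertz_exponent hn
  have hn1 : (n : ℝ) - 1 ≠ 0 := by linarith
  have hint := fun a b => hG.intervalIntegrable_one_sub_pow hG1 n a b
  induction j with
  | zero =>
    simp only [hillKertzEta, hillKertzPhi, Real.zero_rpow he.ne', hv0]
    simp only [mul_zero, zero_add, sub_zero, intervalIntegral.integral_same]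
    rw [mul_div_cancel₀ _ hn1, sub_self, zero_mul]
  | succ j ih =>
    rw [← intervalIntegral.integral_add_adjacent_intervals (hint 0 (v j)) (hint _ _)]
    have h3 := hillKertz_tangent_integral hn hG hG1 (hillKertzEta_nonneg hn hβ j)
      (stopValue_mem_Icc hG hG0 hG1 hv0 hv j).2.1
    have h4 := intervalIntegral.integral_add_adjacent_intervals
      (hG.intervalIntegrable (a := v j) (b := v (j + 1)) (μ := volume))
      (hG.intervalIntegrable (b := 1))
    have h5 := hv j
    have h6 := hv (j + 1)
    have h7 : ((n : ℝ) - 1) * hillKertzEta n (j + 1) β =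
        n * hillKertzEta n j β ^ (((n : ℝ) - 1) / n) + β := by
      simp only [hillKertzEta, hillKertzPhi]; field_simp
    have h8 : v (j + 1) - v j - ∫ x in v j..v (j + 1), G x = v (j + 1 + 1) - v (j + 1) := by
      linarith
    rw [h8] at h3
    rw [h7]
    linarith

/-- If `v` are the optimal stopping values of independent `[0, 1]`-valued variables with common
survival function `G`, then the expected maximum of `n` of them exceeds `v n` by at most `β_n`. -/
theorem hillKertz_inequality {n : ℕ} (hn : 2 ≤ n) {β : ℝ} (hβ : IsHillKertzBeta n β)
    (hG : Antitone G) (hG0 : ∀ x, 0 ≤ G x) (hG1 : ∀ x, G x ≤ 1)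
    (hv0 : v 0 = 0) (hv : ∀ j, v (j + 1) = v j + ∫ x in v j..1, G x) :
    (∫ x in (0 : ℝ)..1, (1 - (1 - G x) ^ n)) - v n ≤ β := by
  obtain ⟨⟨hb0, -⟩, hb⟩ := hβ
  have hint := fun a b => hG.intervalIntegrable_one_sub_pow hG1 n a b
  rw [hillKertzEta_sub hn] at hb
  have hP := hillKertz_partial hn hb0.le hG hG0 hG1 hv0 hv (n - 1)
  have hT := hillKertz_tangent_integral hn hG hG1 (hillKertzEta_nonneg hn hb0.le (n - 1))
      (stopValue_mem_Icc hG hG0 hG1 hv0 hv (n - 1)).2.2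
  have hvn := hv (n - 1)
  rw [Nat.sub_add_cancel (by omega : 1 ≤ n)] at hP hvn
  rw [intervalIntegral.integral_sub (by simp) (hint _ _), intervalIntegral.integral_const,
    ← intervalIntegral.integral_add_adjacent_intervals (hint 0 (v (n - 1))) (hint _ _)]
  simp only [sub_zero, smul_eq_mul, mul_one]
  have h1 : 1 - v (n - 1) - ∫ x in v (n - 1)..1, G x = 1 - v n := by linarith
  rw [h1] at hT
  unfold hillKertzGap at hb
  set η := hillKertzEta n (n - 1) β
  -- The equation for `β` fixes the slope on the last interval `[v (n-1), 1]`. All terms in `η` then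
  -- cancel, leaving `1 - v n - β`.
  have h2 : (n : ℝ) * η ^ (((n : ℝ) - 1) / n) = 1 - β + ((n : ℝ) - 1) * η := by linarith
  rw [h2] at hT
  nlinarith [hP, hT]

end

/-- Recording only the first arrival in each of `n` equal time intervals changes the probability of
observing a given level by at most `(1 - e ^ (-t)) (1 - n (1 - e ^ (-t / n)) / t)`. -/
theorem one_sub_pow_sub_exp_le {n : ℕ} (hn : n ≠ 0) {t p : ℝ} (ht : 0 < t) (hp0 : 0 ≤ p)
    (hp1 : p ≤ 1) :
    (1 - (1 - Real.exp (-t / n)) * p) ^ n - Real.exp (-t * p) ≤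
      (1 - Real.exp (-t)) * (1 - n * (1 - Real.exp (-t / n)) / t) := by
  have hn0 : (0 : ℝ) < n := by positivity
  set q := 1 - Real.exp (-t / n) with hq
  have hq0 : 0 ≤ q := by
    rw [hq, sub_nonneg, Real.exp_le_one_iff]
    exact div_nonpos_of_nonpos_of_nonneg (by linarith) hn0.le
  have hq1 : q ≤ 1 := by rw [hq]; linarith [Real.exp_pos (-t / n)]
  have hqt : n * q / t ≤ 1 := by
    rw [div_le_one ht, hq]
    have := mul_le_mul_of_nonneg_left (Real.add_one_le_exp (-t / n)) hn0.le
    have h2 : (n : ℝ) * (-t / n + 1) = -t + n := by field_simp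
    linarith
  -- Comparing this function at `0` and `p` gives the bound `(1 - n q / t)(1 - e^(-t p))`. Its
  -- derivative is nonnegative since `e^(-t s) ≤ (1 - q s)^n`, by concavity of `s ↦ 1 - e^(-t s /
  -- n)`.
  have hmono : MonotoneOn (fun s => n * q / t * Real.exp (-t * s) - (1 - q * s) ^ n)
      (Set.Icc 0 1) := by
    have hd : ∀ s, HasDerivAt (fun s => n * q / t * Real.exp (-t * s) - (1 - q * s) ^ n)
        (n * q * ((1 - q * s) ^ (n - 1) - Real.exp (-t * s))) s := by
      intro s
      have h1 : HasDerivAt (fun s => -t * s) (-t) s := by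
        simpa using (hasDerivAt_id s).const_mul (-t)
      have h2 : HasDerivAt (fun s => 1 - q * s) (-q) s := by
        simpa using ((hasDerivAt_id s).const_mul q).const_sub 1
      refine ((h1.exp.const_mul (n * q / t)).sub (h2.pow n)).congr_deriv ?_
      field_simp
      ring
    refine monotoneOn_of_deriv_nonneg (convex_Icc 0 1)
      (fun s _ => (hd s).continuousAt.continuousWithinAt)
      (fun s _ => (hd s).differentiableAt.differentiableWithinAt) fun s hs => ?_
    rw [interior_Icc] at hs
    rw [(hd s).deriv]
    refine mul_nonneg (by positivity) (sub_nonneg.2 ?_)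
    have h3 : Real.exp (-t / n * s) ≤ 1 - q * s := by
      have := rpow_le_one_add_mul (Real.exp_pos (-t / n)).le hs.1.le hs.2.le
      rw [← Real.exp_mul] at this
      linarith
    have h4 : Real.exp (-t * s) ≤ (1 - q * s) ^ n := by
      have := pow_le_pow_left₀ (Real.exp_pos _).le h3 n
      rw [← Real.exp_nat_mul] at this
      have he : (n : ℝ) * (-t / n * s) = -t * s := by field_simp
      rwa [he] at this
    have h5 : 1 - q * s ≤ 1 := by nlinarith [hs.1]
    exact h4.trans (pow_le_pow_of_le_one ((Real.exp_pos _).le.trans h3) h5 (Nat.sub_le n 1))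
  have h := hmono (Set.left_mem_Icc.2 zero_le_one) ⟨hp0, hp1⟩ hp0
  simp only [mul_zero, Real.exp_zero, sub_zero, one_pow, mul_one] at h
  have h6 : Real.exp (-t) ≤ Real.exp (-t * p) := Real.exp_le_exp.2 (by nlinarith)
  nlinarith [mul_le_mul_of_nonneg_left h6 (sub_nonneg.2 hqt)]

/-! ### Marked Poisson arrivals -/

/-- Componentwise pairs of two independent sequences of independent variables are independent. -/
theorem iIndepFun_prodMk_of_indepFun {ι α β : Type*} [MeasurableSpace α] [MeasurableSpace β]
    {P : Measure Ω} {X : ι → Ω → α} {T : ι → Ω → β}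
    (hX : ∀ i, Measurable (X i)) (hT : ∀ i, Measurable (T i))
    (hXi : iIndepFun X P) (hTi : iIndepFun T P)
    (hXT : IndepFun (fun ω k => X k ω) (fun ω k => T k ω) P) :
    iIndepFun (fun i ω => (T i ω, X i ω)) P := by
  rw [iIndepFun_iff_iIndep]
  -- Rectangles form a generating π-system, and on them each joint event splits into an event for
  -- `X` and one for `T`.
  refine iIndepSets.iIndep (fun i => ((hT i).prodMk (hX i)).comap_le)
    (fun i => Set.preimage (fun ω => (T i ω, X i ω)) ''
      Set.image2 (· ×ˢ ·) {s | MeasurableSet s} {t | MeasurableSet t})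
    (fun i => ?_) (fun i => ?_) ?_
  · rintro _ ⟨s, hs, rfl⟩ _ ⟨s', hs', rfl⟩ hne
    rw [← Set.preimage_inter] at hne ⊢
    exact ⟨_, isPiSystem_prod _ hs _ hs' (Set.nonempty_of_nonempty_preimage hne), rfl⟩
  · rw [← generateFrom_prod, MeasurableSpace.comap_generateFrom]
  · rw [iIndepSets_iff]
    intro s f hf
    choose! r hr hrf using hf
    simp only [Set.mem_image2, Set.mem_ofPred_eq] at hr
    choose! b hb a ha hab using hr
    have hf' : ∀ i ∈ s, f i = X i ⁻¹' a i ∩ T i ⁻¹' b i := by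
      intro i hi
      rw [← hrf i hi, ← hab i hi]
      ext ω
      simp [and_comm]
    have h1 : ⋂ i ∈ s, f i = (fun ω k => X k ω) ⁻¹' (⋂ i ∈ s, (fun x => x i) ⁻¹' a i) ∩
        (fun ω k => T k ω) ⁻¹' (⋂ i ∈ s, (fun x => x i) ⁻¹' b i) := by
      rw [Set.iInter₂_congr hf']
      ext ω
      simp only [Set.mem_iInter, Set.mem_inter_iff, Set.mem_preimage]
      exact ⟨fun h => ⟨fun i hi => (h i hi).1, fun i hi => (h i hi).2⟩,
        fun h i hi => ⟨h.1 i hi, h.2 i hi⟩⟩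
    rw [h1, hXT.measure_inter_preimage_eq_mul]
    · have h2 := hXi.measure_inter_preimage_eq_mul s (sets := a) ha
      have h3 := hTi.measure_inter_preimage_eq_mul s (sets := b) hb
      simp only [Set.preimage_iInter, Set.preimage_preimage]
      rw [h2, h3, ← Finset.prod_mul_distrib]
      refine Finset.prod_congr rfl fun i hi => ?_
      rw [hf' i hi]
      have h4 := hXT.measure_inter_preimage_eq_mul ((fun x => x i) ⁻¹' a i)
        ((fun x => x i) ⁻¹' b i) (measurable_pi_apply i (ha i hi)) (measurable_pi_apply i (hb i hi))
      exact h4.symm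
    · exact MeasurableSet.biInter s.countable_toSet fun i hi => measurable_pi_apply i (ha i hi)
    · exact MeasurableSet.biInter s.countable_toSet fun i hi => measurable_pi_apply i (hb i hi)

/-- The last arrival time before the arrival with index `k`, with value `0` for `k = 0`. -/
noncomputable def prevArrival (S : ℕ → Ω → ℝ) (k : ℕ) (ω : Ω) : ℝ :=
  ∑ i ∈ Finset.range k, interarrival S i ω

/-- The σ-algebra generated by the observations with index less than `k`. -/
abbrev priorSigma (X S : ℕ → Ω → ℝ) (k : ℕ) : MeasurableSpace Ω :=
  ⨆ j ∈ Finset.range k, MeasurableSpace.comap (fun ω => (X j ω, S j ω)) inferInstance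

lemma prevArrival_succ (S : ℕ → Ω → ℝ) (k : ℕ) (ω : Ω) : prevArrival S (k + 1) ω = S k ω := by
  induction k with
  | zero => simp [prevArrival, interarrival]
  | succ k ih =>
    rw [prevArrival, Finset.sum_range_succ]
    rw [prevArrival] at ih
    rw [ih]
    simp [interarrival]

lemma prevArrival_add_interarrival (S : ℕ → Ω → ℝ) (k : ℕ) (ω : Ω) :
    prevArrival S k ω + interarrival S k ω = S k ω := by
  rw [← prevArrival_succ S k, prevArrival, prevArrival, Finset.sum_range_succ]

lemma prevArrival_zero (S : ℕ → Ω → ℝ) (ω : Ω) : prevArrival S 0 ω = 0 := by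
  simp [prevArrival]

lemma comap_le_priorSigma (X S : ℕ → Ω → ℝ) {j k : ℕ} (h : j < k) :
    MeasurableSpace.comap (fun ω => (X j ω, S j ω)) inferInstance ≤ priorSigma X S k :=
  le_iSup₂_of_le j (Finset.mem_range.2 h) le_rfl

lemma priorSigma_mono (X S : ℕ → Ω → ℝ) {j k : ℕ} (h : j ≤ k) :
    priorSigma X S j ≤ priorSigma X S k :=
  iSup₂_le fun _ hi => comap_le_priorSigma X S ((Finset.mem_range.1 hi).trans_le h)

lemma measurable_observation (X S : ℕ → Ω → ℝ) {j k : ℕ} (h : j < k) :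
    Measurable[priorSigma X S k] fun ω => (X j ω, S j ω) :=
  Measurable.mono (comap_measurable _) (comap_le_priorSigma X S h) le_rfl

lemma measurable_prevArrival (X S : ℕ → Ω → ℝ) (k : ℕ) :
    Measurable[priorSigma X S k] (prevArrival S k) := by
  cases k with
  | zero =>
    have : prevArrival S 0 = fun _ => (0 : ℝ) := funext (prevArrival_zero S)
    rw [this]
    exact measurable_const
  | succ k =>
    have : prevArrival S (k + 1) = fun ω => S k ω := funext (prevArrival_succ S k)
    rw [this]
    exact measurable_snd.comp (measurable_observation X S (Nat.lt_succ_self k))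

/-- A unit rate Poisson process `S` with independent marks `X` in `[0, 1]` of law `μ`. -/
structure IsMarkedPoisson (X S : ℕ → Ω → ℝ) (μ : Measure ℝ) (P : Measure Ω) : Prop where
  measurable_mark : ∀ k, Measurable (X k)
  measurable_arrival : ∀ k, Measurable (S k)
  mark_mem : ∀ k ω, X k ω ∈ Set.Icc (0 : ℝ) 1
  law_mem : ∀ᵐ x ∂μ, x ∈ Set.Icc (0 : ℝ) 1
  indep : iIndepFun (fun k ω => (interarrival S k ω, X k ω)) P
  law : ∀ k, P.map (fun ω => (interarrival S k ω, X k ω)) = (expMeasure 1).prod μ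

namespace IsMarkedPoisson

variable {X S : ℕ → Ω → ℝ} {μ : Measure ℝ} {P : Measure Ω}

lemma measurable_interarrival (h : IsMarkedPoisson X S μ P) (k : ℕ) :
    Measurable (interarrival S k) := by
  cases k with
  | zero => exact h.measurable_arrival 0
  | succ k => exact (h.measurable_arrival (k + 1)).sub (h.measurable_arrival k)

lemma priorSigma_le (h : IsMarkedPoisson X S μ P) (k : ℕ) :
    priorSigma X S k ≤ (inferInstance : MeasurableSpace Ω) :=
  iSup₂_le fun j _ => ((h.measurable_mark j).prodMk (h.measurable_arrival j)).comap_le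

/-- Each earlier arrival time is a sum of earlier waiting times, so the past is a function of the
earlier pairs (waiting time, mark). -/
lemma indep_priorSigma (h : IsMarkedPoisson X S μ P) (k : ℕ) :
    Indep (priorSigma X S k)
      (MeasurableSpace.comap (fun ω => (interarrival S k ω, X k ω)) inferInstance) P := by
  have h1 := indep_iSup_of_disjoint
    (fun i => ((h.measurable_interarrival i).prodMk (h.measurable_mark i)).comap_le)
    h.indep.iIndep (S := Set.Iio k) (T := {k}) (by simp)
  rw [iSup_singleton] at h1
  refine indep_of_indep_of_le_left h1 (iSup₂_le fun j hj => ?_)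
  rw [Finset.mem_range] at hj
  have hm : ∀ i ∈ Set.Iio k, Measurable[⨆ i ∈ Set.Iio k, MeasurableSpace.comap
      (fun ω => (interarrival S i ω, X i ω)) inferInstance]
      fun ω => (interarrival S i ω, X i ω) := fun i hi =>
    Measurable.mono (comap_measurable _) (le_iSup₂_of_le i hi le_rfl) le_rfl
  refine Measurable.comap_le (Measurable.prodMk (measurable_snd.comp (hm j hj)) ?_)
  have hS : S j = fun ω => ∑ i ∈ Finset.range (j + 1), interarrival S i ω :=
    funext fun ω => (prevArrival_succ S j ω).symm
  rw [hS]
  refine Finset.measurable_fun_sum _ fun i hi => measurable_fst.comp (hm i ?_)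
  exact lt_of_lt_of_le (Finset.mem_range.1 hi) hj

/-- Conditioning on the observations before index `k`: the waiting time is exponential and the mark
has law `μ`. -/
theorem integral_mul_observation [IsProbabilityMeasure P] [IsProbabilityMeasure μ]
    (h : IsMarkedPoisson X S μ P) (k : ℕ) {H : Ω → ℝ}
    (hH : Measurable[priorSigma X S k] H) (hH1 : ∀ ω, |H ω| ≤ 1) {g : ℝ × ℝ → ℝ}
    (hg : Measurable g) {C : ℝ} (hgC : ∀ y, ∀ x ∈ Set.Icc (0 : ℝ) 1, |g (y, x)| ≤ C) :
    ∫ ω, H ω * g (S k ω, X k ω) ∂P =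
      ∫ ω, H ω * (∫ u, ∫ x, g (prevArrival S k ω + u, x) ∂μ ∂(expMeasure 1)) ∂P := by
  have : IsProbabilityMeasure (expMeasure 1) := isProbabilityMeasure_expMeasure one_pos
  have hpast : Measurable[priorSigma X S k] fun ω => (H ω, prevArrival S k ω) :=
    hH.prodMk (measurable_prevArrival X S k)
  have hpast' : Measurable fun ω => (H ω, prevArrival S k ω) :=
    hpast.mono (h.priorSigma_le k) le_rfl
  have hZ : Measurable fun ω => (interarrival S k ω, X k ω) :=
    (h.measurable_interarrival k).prodMk (h.measurable_mark k)
  have hind : IndepFun (fun ω => (H ω, prevArrival S k ω))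
      (fun ω => (interarrival S k ω, X k ω)) P :=
    indep_of_indep_of_le_left (h.indep_priorSigma k) hpast.comap_le
  have hmap := hind.map_prod_eq_prod_map_map hpast'.aemeasurable hZ.aemeasurable
  rw [h.law k] at hmap
  set φ : (ℝ × ℝ) × (ℝ × ℝ) → ℝ := fun z => z.1.1 * g (z.1.2 + z.2.1, z.2.2) with hφ
  have hφm : Measurable φ := by fun_prop
  have hφi : Integrable φ ((P.map fun ω => (H ω, prevArrival S k ω)).prod
      ((expMeasure 1).prod μ)) := by
    rw [← hmap, integrable_map_measure hφm.aestronglyMeasurable (hpast'.prodMk hZ).aemeasurable]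
    refine Integrable.of_bound (hφm.comp (hpast'.prodMk hZ)).aestronglyMeasurable (1 * C)
      (ae_of_all _ fun ω => ?_)
    simp only [hφ, Function.comp, Real.norm_eq_abs, abs_mul]
    exact mul_le_mul (hH1 ω) (hgC _ _ (h.mark_mem k ω)) (abs_nonneg _) zero_le_one
  have h1 : ∫ ω, H ω * g (S k ω, X k ω) ∂P =
      ∫ z, φ z ∂(P.map fun ω => ((H ω, prevArrival S k ω), (interarrival S k ω, X k ω))) := by
    rw [integral_map (hpast'.prodMk hZ).aemeasurable hφm.aestronglyMeasurable]
    simp only [hφ, prevArrival_add_interarrival]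
  rw [h1, hmap, integral_prod _ hφi, integral_map hpast'.aemeasurable
    hφi.aestronglyMeasurable.integral_prod_right']
  congr 1 with ω
  simp only [hφ]
  rw [integral_const_mul, integral_prod]
  have hgm : Measurable fun z : ℝ × ℝ => g (prevArrival S k ω + z.1, z.2) := by fun_prop
  refine Integrable.of_bound hgm.aestronglyMeasurable C ?_
  -- `g` is bounded only for marks in `[0, 1]`, which carry `μ`.
  have h2 : ∀ᵐ z ∂((expMeasure 1).prod μ), z.2 ∈ Set.Icc (0 : ℝ) 1 :=
    Measure.quasiMeasurePreserving_snd.ae h.law_mem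
  filter_upwards [h2] with z hz using hgC _ _ hz

end IsMarkedPoisson

/-! ### Integrals against the exponential law -/

lemma integral_expMeasure_one (f : ℝ → ℝ) :
    ∫ u, f u ∂(expMeasure 1) = ∫ u in Set.Ioi (0 : ℝ), Real.exp (-u) * f u := by
  have h : expMeasure 1 = (volume : Measure ℝ).withDensity (exponentialPDF 1) := rfl
  have hm : Measurable (exponentialPDF 1) := (measurable_exponentialPDFReal 1).ennreal_ofReal
  rw [h, integral_withDensity_eq_integral_toReal_smul hm (by simp [exponentialPDF]),
    ← integral_Ici_eq_integral_Ioi, ← integral_indicator measurableSet_Ici]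
  congr 1 with u
  by_cases hu : 0 ≤ u
  · rw [Set.indicator_of_mem (by exact hu), exponentialPDF_of_nonneg hu,
      ENNReal.toReal_ofReal (by positivity)]
    simp
  · rw [Set.indicator_of_notMem (by exact hu), exponentialPDF_of_neg (not_le.1 hu)]
    simp

/-- Expectation, over an exponential waiting time, of a reward that is constant after time `s`. -/
lemma integral_expMeasure_one_ite {f : ℝ → ℝ} (hf : Continuous f) (c : ℝ) {s : ℝ} (hs : 0 ≤ s) :
    ∫ u, (if u ≤ s then f u else c) ∂(expMeasure 1) =
      (∫ u in (0 : ℝ)..s, Real.exp (-u) * f u) + c * Real.exp (-s) := by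
  rw [integral_expMeasure_one]
  have hI : IntegrableOn (fun u => Real.exp (-u) * f u) (Set.Ioc 0 s) :=
    (Continuous.integrableOn_Icc (by fun_prop)).mono_set Set.Ioc_subset_Icc_self
  have h1 : Set.EqOn (fun u => Real.exp (-u) * if u ≤ s then f u else c)
      (fun u => Real.exp (-u) * f u) (Set.Ioc 0 s) := fun u hu => by simp [hu.2]
  have h2 : Set.EqOn (fun u => Real.exp (-u) * if u ≤ s then f u else c)
      (fun u => c * Real.exp (-u)) (Set.Ioi s) := fun u hu => by
    simp [not_le.2 (Set.mem_Ioi.1 hu), mul_comm]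
  rw [← Set.Ioc_union_Ioi_eq_Ioi hs, setIntegral_union (Set.Ioc_disjoint_Ioi le_rfl)
    measurableSet_Ioi (hI.congr_fun h1.symm measurableSet_Ioc)
    (IntegrableOn.congr_fun ((integrableOn_exp_neg_Ioi s).const_mul c) h2.symm measurableSet_Ioi),
    setIntegral_congr_fun measurableSet_Ioc h1, setIntegral_congr_fun measurableSet_Ioi h2,
    integral_const_mul, integral_exp_neg_Ioi, intervalIntegral.integral_of_le hs]

lemma integral_expMeasure_one_ite_of_neg (f : ℝ → ℝ) (c : ℝ) {s : ℝ} (hs : s < 0) :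
    ∫ u, (if u ≤ s then f u else c) ∂(expMeasure 1) = c := by
  rw [integral_expMeasure_one]
  have h2 : Set.EqOn (fun u => Real.exp (-u) * if u ≤ s then f u else c)
      (fun u => c * Real.exp (-u)) (Set.Ioi 0) := fun u hu => by
    simp [not_le.2 (hs.trans (Set.mem_Ioi.1 hu)), mul_comm]
  rw [setIntegral_congr_fun measurableSet_Ioi h2, integral_const_mul, integral_exp_neg_Ioi]
  simp

/-- The event that none of the observations with index `i < k` lies in `B i`. -/
def survivalSet (X S : ℕ → Ω → ℝ) (B : ℕ → Set (ℝ × ℝ)) (k : ℕ) : Set Ω :=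
  {ω | ∀ i < k, (X i ω, S i ω) ∉ B i}

/-- The indicator function of `survivalSet`. -/
noncomputable def survival (X S : ℕ → Ω → ℝ) (B : ℕ → Set (ℝ × ℝ)) (k : ℕ) : Ω → ℝ :=
  (survivalSet X S B k).indicator 1

section survival

variable {X S : ℕ → Ω → ℝ} {B : ℕ → Set (ℝ × ℝ)}

lemma measurableSet_survivalSet (hB : ∀ i, MeasurableSet (B i)) (k : ℕ) :
    MeasurableSet[priorSigma X S k] (survivalSet X S B k) := by
  have h : survivalSet X S B k =
      ⋂ i ∈ Finset.range k, (fun ω => (X i ω, S i ω)) ⁻¹' (B i)ᶜ := by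
    ext ω
    simp [survivalSet]
  rw [h]
  exact Finset.measurableSet_biInter _ fun i hi =>
    measurable_observation X S (Finset.mem_range.1 hi) (hB i).compl

lemma measurable_survival (hB : ∀ i, MeasurableSet (B i)) (k : ℕ) :
    Measurable[priorSigma X S k] (survival X S B k) :=
  Measurable.indicator measurable_const (measurableSet_survivalSet hB k)

lemma survival_nonneg (k : ℕ) (ω : Ω) : 0 ≤ survival X S B k ω :=
  Set.indicator_nonneg (fun _ _ => zero_le_one) ω

lemma survival_le_one (k : ℕ) (ω : Ω) : survival X S B k ω ≤ 1 :=
  Set.indicator_le_self' (fun _ _ => zero_le_one) ω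

lemma abs_survival_le_one (k : ℕ) (ω : Ω) : |survival X S B k ω| ≤ 1 := by
  rw [abs_of_nonneg (survival_nonneg k ω)]
  exact survival_le_one k ω

lemma survival_zero (ω : Ω) : survival X S B 0 ω = 1 := by
  simp [survival, survivalSet]

open Classical in
lemma survival_succ (k : ℕ) (ω : Ω) : survival X S B (k + 1) ω =
    survival X S B k ω * if (X k ω, S k ω) ∈ B k then 0 else 1 := by
  have h : ω ∈ survivalSet X S B (k + 1) ↔
      ω ∈ survivalSet X S B k ∧ (X k ω, S k ω) ∉ B k := by
    simp only [survivalSet, Set.mem_ofPred_eq, Nat.lt_succ_iff_lt_or_eq]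
    exact ⟨fun h => ⟨fun i hi => h i (Or.inl hi), h k (Or.inr rfl)⟩,
      fun h i hi => hi.elim (h.1 i) fun e => e ▸ h.2⟩
  by_cases h1 : ω ∈ survivalSet X S B k <;> by_cases h2 : (X k ω, S k ω) ∈ B k <;>
    simp [survival, Set.indicator, h, h1, h2]

end survival

/-! ### The prophet -/

/-- Adding `e^(-s)`, the probability of no arrival, gives `e^(-p s)`: this is the one-step identity
for the probability that no mark of tail probability `p` arrives during time `s`. -/
lemma integral_exp_thinning (p s : ℝ) :
    (∫ u in (0 : ℝ)..s, Real.exp (-u) * ((1 - p) * Real.exp (-p * (s - u)))) =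
      Real.exp (-p * s) - Real.exp (-s) := by
  have hd : ∀ u ∈ Set.uIcc 0 s, HasDerivAt (fun u => -Real.exp (-u + -p * (s - u)))
      (Real.exp (-u) * ((1 - p) * Real.exp (-p * (s - u)))) u := by
    intro u _
    have h1 : HasDerivAt (fun u : ℝ => -u + -p * (s - u)) (-1 + -p * (-1)) u :=
      (hasDerivAt_id u).neg.add (((hasDerivAt_id u).const_sub s).const_mul (-p))
    refine h1.exp.neg.congr_deriv ?_
    rw [Real.exp_add]
    ring
  rw [intervalIntegral.integral_eq_sub_of_hasDerivAt hd
    (Continuous.intervalIntegrable (by fun_prop) _ _)]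
  simp only [sub_self, mul_zero, add_zero, neg_zero, zero_add, sub_zero]
  ring

namespace IsMarkedPoisson

variable {X S : ℕ → Ω → ℝ} {μ : Measure ℝ} {P : Measure Ω} [IsProbabilityMeasure P]
  [IsProbabilityMeasure μ]

/-- The integrand is the conditional probability, after `k` arrivals, that no mark above `x` ever
arrives by time `t`. It is a martingale in `k`, so its mean keeps its initial value. -/
lemma integral_survival_mul_exp (h : IsMarkedPoisson X S μ P) {t x : ℝ} (ht : 0 ≤ t) (k : ℕ) :
    ∫ ω, survival X S (fun _ => Set.Ioi x ×ˢ Set.Iic t) k ω *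
      Real.exp (-μ.real (Set.Ioi x) * max (t - prevArrival S k ω) 0) ∂P =
        Real.exp (-μ.real (Set.Ioi x) * t) := by
  classical
  set p := μ.real (Set.Ioi x) with hp
  have hB : ∀ i : ℕ, MeasurableSet ((fun _ => Set.Ioi x ×ˢ Set.Iic t) i) :=
    fun _ => measurableSet_Ioi.prod measurableSet_Iic
  induction k with
  | zero => simp [survival_zero, prevArrival_zero, ht]
  | succ k ih =>
    rw [← ih]
    set g : ℝ × ℝ → ℝ := fun z => if z ∈ Set.Iic t ×ˢ Set.Ioi x then 0 else
      Real.exp (-p * max (t - z.1) 0) with hg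
    have hgm : Measurable g :=
      Measurable.ite (measurableSet_Iic.prod measurableSet_Ioi) measurable_const (by fun_prop)
    have hgC : ∀ y, ∀ x' ∈ Set.Icc (0 : ℝ) 1, |g (y, x')| ≤ 1 := by
      intro y x' _
      simp only [hg]
      split_ifs
      · simp
      · rw [abs_of_pos (Real.exp_pos _), Real.exp_le_one_iff]
        have h1 : 0 ≤ p := measureReal_nonneg
        have h2 : 0 ≤ max (t - y) 0 := le_max_right _ _
        nlinarith
    have hone := h.integral_mul_observation k (measurable_survival hB k)
      (fun ω => abs_survival_le_one k ω) hgm hgC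
    have hmark : ∀ y, ∫ x', g (y, x') ∂μ =
        if y ≤ t then (1 - p) * Real.exp (-p * (t - y)) else 1 := by
      intro y
      split_ifs with hy
      · have h1 : (fun x' => g (y, x')) =
            (Set.Iic x).indicator fun _ => Real.exp (-p * (t - y)) := by
          funext x'
          by_cases hx : x < x'
          · simp [hg, hy, hx]
          · simp [hg, hy, hx, not_lt.1 hx]
        rw [h1, integral_indicator_const _ measurableSet_Iic, ← Set.compl_Ioi,
          probReal_compl_eq_one_sub measurableSet_Ioi, smul_eq_mul]
      · simp [hg, hy, max_eq_right (sub_nonpos.2 (not_le.1 hy).le)]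
    have hK : ∀ r, ∫ u, ∫ x', g (r + u, x') ∂μ ∂(expMeasure 1) =
        Real.exp (-p * max (t - r) 0) := by
      intro r
      have h1 : ∀ u, ∫ x', g (r + u, x') ∂μ =
          if u ≤ t - r then (1 - p) * Real.exp (-p * (t - r - u)) else 1 := by
        intro u
        rw [hmark]
        congr 1
        · rw [le_sub_iff_add_le, add_comm]
        · rw [sub_sub]
      simp_rw [h1]
      rcases le_or_gt 0 (t - r) with hr | hr
      · rw [integral_expMeasure_one_ite (by fun_prop) 1 hr, integral_exp_thinning,
          max_eq_left hr]
        ring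
      · rw [integral_expMeasure_one_ite_of_neg _ _ hr, max_eq_right hr.le]
        simp
    simp_rw [hK] at hone
    rw [← hone]
    congr 1 with ω
    rw [survival_succ, prevArrival_succ, mul_assoc]
    congr 1
    simp only [hg, Set.mem_prod, Set.mem_Iic, Set.mem_Ioi, and_comm]
    split_ifs <;> simp

lemma payoff_mem_Icc (h : IsMarkedPoisson X S μ P) (t : ℝ) (k : ℕ) (ω : Ω) :
    payoff X S t k ω ∈ Set.Icc (0 : ℝ) 1 := by
  unfold payoff
  split_ifs
  · exact h.mark_mem k ω
  · simp

lemma measurable_payoff (h : IsMarkedPoisson X S μ P) (t : ℝ) (k : ℕ) :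
    Measurable (payoff X S t k) :=
  Measurable.ite (h.measurable_arrival k measurableSet_Iic) (h.measurable_mark k) measurable_const

lemma bddAbove_payoff (h : IsMarkedPoisson X S μ P) (t : ℝ) (ω : Ω) :
    BddAbove (Set.range fun k => payoff X S t k ω) :=
  ⟨1, by rintro _ ⟨k, rfl⟩; exact (h.payoff_mem_Icc t k ω).2⟩

lemma iSup_payoff_mem_Icc (h : IsMarkedPoisson X S μ P) (t : ℝ) (ω : Ω) :
    (⨆ k, payoff X S t k ω) ∈ Set.Icc (0 : ℝ) 1 :=
  ⟨(h.payoff_mem_Icc t 0 ω).1.trans (le_ciSup (h.bddAbove_payoff t ω) 0),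
    ciSup_le fun k => (h.payoff_mem_Icc t k ω).2⟩

/-- Dropping the exponential factor, at most `1`, bounds every survival probability below, and the
bound passes to the intersection. Only this inequality is needed, so divergence of the arrival times
plays no role. -/
lemma prob_lt_iSup_payoff_le (h : IsMarkedPoisson X S μ P) {t x : ℝ} (ht : 0 ≤ t) (hx : 0 ≤ x) :
    P.real {ω | x < ⨆ k, payoff X S t k ω} ≤ 1 - Real.exp (-t * μ.real (Set.Ioi x)) := by
  set B : ℕ → Set (ℝ × ℝ) := fun _ => Set.Ioi x ×ˢ Set.Iic t with hBdef
  have hB : ∀ i : ℕ, MeasurableSet (B i) := fun _ => measurableSet_Ioi.prod measurableSet_Iic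
  have hms : ∀ k, MeasurableSet (survivalSet X S B k) := fun k =>
    h.priorSigma_le k _ (measurableSet_survivalSet hB k)
  have hge : ∀ k, Real.exp (-t * μ.real (Set.Ioi x)) ≤ P.real (survivalSet X S B k) := by
    intro k
    have h1 := h.integral_survival_mul_exp (x := x) ht k
    have h2 : ∫ ω, survival X S B k ω ∂P = P.real (survivalSet X S B k) := by
      rw [survival, integral_indicator_one (hms k)]
    rw [neg_mul, mul_comm, ← neg_mul, ← h1, ← h2]
    refine integral_mono_of_nonneg (ae_of_all _ fun ω =>
      mul_nonneg (survival_nonneg k ω) (Real.exp_pos _).le) ?_ (ae_of_all _ fun ω => ?_)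
    · exact (integrable_const (1 : ℝ)).indicator (hms k)
    · refine mul_le_of_le_one_right (survival_nonneg k ω) (Real.exp_le_one_iff.2 ?_)
      have h3 : 0 ≤ μ.real (Set.Ioi x) := measureReal_nonneg
      have h4 : 0 ≤ max (t - prevArrival S k ω) 0 := le_max_right _ _
      nlinarith
  have hset : {ω | x < ⨆ k, payoff X S t k ω} = (⋂ k, survivalSet X S B k)ᶜ := by
    ext ω
    rw [Set.mem_ofPred_eq, lt_ciSup_iff (h.bddAbove_payoff t ω), Set.mem_compl_iff,
      Set.mem_iInter]
    simp only [survivalSet, Set.mem_ofPred_eq, not_forall, not_not, hBdef, payoff]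
    constructor
    · rintro ⟨k, hk⟩
      refine ⟨k + 1, k, Nat.lt_succ_self k, ?_⟩
      split_ifs at hk with hS
      · exact ⟨hk, hS⟩
      · exact absurd hk (not_lt.2 hx)
    · rintro ⟨-, k, -, hk⟩
      exact ⟨k, by rw [if_pos (show S k ω ≤ t from hk.2)]; exact hk.1⟩
  have hanti : Antitone (survivalSet X S B) := fun i j hij ω hω m hm => hω m (hm.trans_le hij)
  have hlim := tendsto_measure_iInter_atTop (μ := P) (fun k => (hms k).nullMeasurableSet) hanti
    ⟨0, measure_ne_top _ _⟩
  have hlim' := (ENNReal.tendsto_toReal (measure_ne_top P _)).comp hlim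
  rw [hset, probReal_compl_eq_one_sub (MeasurableSet.iInter hms)]
  have := ge_of_tendsto' hlim' hge
  exact sub_le_sub_left this 1

theorem prophetValue_le (h : IsMarkedPoisson X S μ P) {t : ℝ} (ht : 0 ≤ t) :
    prophetValue X S P t ≤ ∫ x in (0 : ℝ)..1, (1 - Real.exp (-t * μ.real (Set.Ioi x))) := by
  have hm : Measurable fun ω => ⨆ k, payoff X S t k ω := Measurable.iSup (h.measurable_payoff t)
  have hint : Integrable (fun ω => ⨆ k, payoff X S t k ω) P :=
    Integrable.of_bound hm.aestronglyMeasurable 1 (ae_of_all _ fun ω => by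
      rw [Real.norm_eq_abs, abs_of_nonneg (h.iSup_payoff_mem_Icc t ω).1]
      exact (h.iSup_payoff_mem_Icc t ω).2)
  rw [prophetValue, hint.integral_eq_integral_meas_lt
    (ae_of_all _ fun ω => (h.iSup_payoff_mem_Icc t ω).1),
    intervalIntegral.integral_of_le zero_le_one,
    setIntegral_eq_of_subset_of_forall_sdiff_eq_zero measurableSet_Ioi
      (fun x hx => hx.1 : Set.Ioc (0 : ℝ) 1 ⊆ Set.Ioi 0)]
  · refine integral_mono_of_nonneg (ae_of_all _ fun x => measureReal_nonneg) ?_ ?_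
    · have hanti : Antitone fun x => 1 - Real.exp (-t * μ.real (Set.Ioi x)) := by
        intro x y hxy
        have h1 : μ.real (Set.Ioi y) ≤ μ.real (Set.Ioi x) :=
          measureReal_mono (Set.Ioi_subset_Ioi hxy)
        exact sub_le_sub_left (Real.exp_le_exp.2 (by nlinarith)) 1
      exact (intervalIntegrable_iff_integrableOn_Ioc_of_le zero_le_one).1 hanti.intervalIntegrable
    · filter_upwards [ae_restrict_mem measurableSet_Ioc] with x hx
      exact h.prob_lt_iSup_payoff_le ht hx.1.le
  · rintro x ⟨hx0, hx1⟩
    have hx : 1 < x := by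
      by_contra! hx
      exact hx1 ⟨hx0, hx⟩
    have : {ω | x < ⨆ k, payoff X S t k ω} = ∅ := by
      ext ω
      simpa using (h.iSup_payoff_mem_Icc t ω).2.trans hx.le
    rw [this, measureReal_empty]

end IsMarkedPoisson

/-! ### The value iteration -/

/-- The optimal value, with time `s` left, when at most `m` further arrivals are considered and
`Ψ v` is the expected maximum of a mark and `v`. -/
noncomputable def valueIteration (Ψ : ℝ → ℝ) : ℕ → ℝ → ℝ
  | 0, _ => 0
  | m + 1, s => Real.exp (-max s 0) *
      ∫ r in (0 : ℝ)..max s 0, Real.exp r * Ψ (valueIteration Ψ m r)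

section valueIteration

variable {Ψ : ℝ → ℝ}

lemma continuous_valueIteration (hc : Continuous Ψ) (m : ℕ) : Continuous (valueIteration Ψ m) := by
  induction m with
  | zero => exact continuous_const
  | succ m ih =>
    have h1 : Continuous fun b : ℝ => ∫ r in (0 : ℝ)..b, Real.exp r * Ψ (valueIteration Ψ m r) :=
      intervalIntegral.continuous_primitive
        (fun a b => Continuous.intervalIntegrable (by fun_prop) a b) 0
    have h2 : Continuous fun s : ℝ => max s 0 := by fun_prop
    have h3 := h1.comp h2
    simp only [Function.comp_def] at h3
    have h4 : Continuous fun s : ℝ => Real.exp (-max s 0) := by fun_prop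
    exact h4.mul h3

lemma valueIteration_of_nonpos (m : ℕ) {s : ℝ} (hs : s ≤ 0) : valueIteration Ψ m s = 0 := by
  cases m with
  | zero => rfl
  | succ m => simp [valueIteration, hs]

/-- Here `u` is the waiting time for the next arrival. The definition integrates over the remaining
time `r = s - u` instead, which makes continuity in `s` evident. -/
lemma valueIteration_succ_of_nonneg (m : ℕ) {s : ℝ} (hs : 0 ≤ s) :
    valueIteration Ψ (m + 1) s =
      ∫ u in (0 : ℝ)..s, Real.exp (-u) * Ψ (valueIteration Ψ m (s - u)) := by
  have h := intervalIntegral.integral_comp_sub_left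
    (fun r => Real.exp (-s) * (Real.exp r * Ψ (valueIteration Ψ m r))) s (a := 0) (b := s)
  rw [sub_self, sub_zero] at h
  simp only [valueIteration, max_eq_left hs]
  rw [← intervalIntegral.integral_const_mul, ← h]
  congr 1 with u
  rw [← mul_assoc, ← Real.exp_add]
  ring_nf

lemma intervalIntegrable_valueIteration (hc : Continuous Ψ) (m : ℕ) (a b : ℝ) :
    IntervalIntegrable (fun r => Real.exp r * Ψ (valueIteration Ψ m r)) volume a b := by
  have := continuous_valueIteration hc m
  exact Continuous.intervalIntegrable (by fun_prop) a b

lemma integral_exp_mul_const (a b c : ℝ) :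
    ∫ r in a..b, Real.exp r * c = (Real.exp b - Real.exp a) * c := by
  rw [intervalIntegral.integral_mul_const, integral_exp]

lemma valueIteration_mem_Icc (hc : Continuous Ψ)
    (hΨ : ∀ v ∈ Set.Icc (0 : ℝ) 1, Ψ v ∈ Set.Icc (0 : ℝ) 1) (m : ℕ) (s : ℝ) :
    valueIteration Ψ m s ∈ Set.Icc (0 : ℝ) 1 := by
  induction m generalizing s with
  | zero => simp [valueIteration]
  | succ m ih =>
    simp only [valueIteration]
    have hs : 0 ≤ max s 0 := le_max_right _ _
    generalize max s 0 = b at hs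
    have h0 : 0 ≤ ∫ r in (0 : ℝ)..b, Real.exp r * Ψ (valueIteration Ψ m r) :=
      intervalIntegral.integral_nonneg hs fun r _ =>
        mul_nonneg (Real.exp_pos r).le (hΨ _ (ih r)).1
    have h1 : ∫ r in (0 : ℝ)..b, Real.exp r * Ψ (valueIteration Ψ m r) ≤
        ∫ r in (0 : ℝ)..b, Real.exp r * 1 := by
      refine intervalIntegral.integral_mono_on hs (intervalIntegrable_valueIteration hc m _ _)
        (Continuous.intervalIntegrable (by fun_prop) _ _) fun r _ => ?_
      exact mul_le_mul_of_nonneg_left (hΨ _ (ih r)).2 (Real.exp_pos r).le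
    rw [integral_exp_mul_const, mul_one, Real.exp_zero] at h1
    refine ⟨mul_nonneg (Real.exp_pos _).le h0, ?_⟩
    have h2 := mul_le_mul_of_nonneg_left h1 (Real.exp_pos (-b)).le
    rw [mul_sub, ← Real.exp_add] at h2
    simp only [neg_add_cancel, Real.exp_zero, mul_one] at h2
    linarith [Real.exp_pos (-b)]

lemma valueIteration_mono_time (hc : Continuous Ψ) (hm : Monotone Ψ)
    (hΨ : ∀ v ∈ Set.Icc (0 : ℝ) 1, Ψ v ∈ Set.Icc (0 : ℝ) 1) (m : ℕ) :
    Monotone (valueIteration Ψ m) := by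
  induction m with
  | zero => exact monotone_const
  | succ m ih =>
    intro a b hab
    have hcm := continuous_valueIteration hc m
    rcases le_total a 0 with ha | ha
    · rw [valueIteration_of_nonpos _ ha]
      exact (valueIteration_mem_Icc hc hΨ _ _).1
    rw [valueIteration_succ_of_nonneg m ha, valueIteration_succ_of_nonneg m (ha.trans hab)]
    have hi : ∀ s c d, IntervalIntegrable
        (fun u => Real.exp (-u) * Ψ (valueIteration Ψ m (s - u))) volume c d :=
      fun s c d => Continuous.intervalIntegrable (by fun_prop) c d
    rw [← intervalIntegral.integral_add_adjacent_intervals (hi b 0 a) (hi b a b)]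
    have h1 : 0 ≤ ∫ u in a..b, Real.exp (-u) * Ψ (valueIteration Ψ m (b - u)) :=
      intervalIntegral.integral_nonneg hab fun u _ =>
        mul_nonneg (Real.exp_pos _).le (hΨ _ (valueIteration_mem_Icc hc hΨ m _)).1
    have h2 := intervalIntegral.integral_mono_on ha (hi a 0 a) (hi b 0 a) fun u _ =>
      mul_le_mul_of_nonneg_left (hm (ih (sub_le_sub_right hab u))) (Real.exp_pos (-u)).le
    linarith

lemma valueIteration_mono_index (hc : Continuous Ψ) (hm : Monotone Ψ)
    (hΨ : ∀ v ∈ Set.Icc (0 : ℝ) 1, Ψ v ∈ Set.Icc (0 : ℝ) 1) (s : ℝ) :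
    Monotone fun m => valueIteration Ψ m s := by
  refine monotone_nat_of_le_succ fun m => ?_
  induction m generalizing s with
  | zero => exact (valueIteration_mem_Icc hc hΨ 1 s).1
  | succ m ih =>
    refine mul_le_mul_of_nonneg_left ?_ (Real.exp_pos _).le
    refine intervalIntegral.integral_mono_on (le_max_right _ _)
      (intervalIntegrable_valueIteration hc m _ _)
      (intervalIntegrable_valueIteration hc (m + 1) _ _) fun r _ => ?_
    exact mul_le_mul_of_nonneg_left (hm (ih r)) (Real.exp_pos r).le

/-- The integral over remaining times in `[0, s]` gives the first term. On `[s, s + d]` the value of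
continuing is at least that at `s`, which gives the second. -/
lemma valueIteration_add_ge (hc : Continuous Ψ) (hm : Monotone Ψ)
    (hΨ : ∀ v ∈ Set.Icc (0 : ℝ) 1, Ψ v ∈ Set.Icc (0 : ℝ) 1) (m : ℕ) {s d : ℝ} (hs : 0 ≤ s)
    (hd : 0 ≤ d) :
    Real.exp (-d) * valueIteration Ψ (m + 1) s + (1 - Real.exp (-d)) * Ψ (valueIteration Ψ m s) ≤
      valueIteration Ψ (m + 1) (s + d) := by
  have hi := intervalIntegrable_valueIteration hc m
  simp only [valueIteration, max_eq_left hs, max_eq_left (add_nonneg hs hd)]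
  rw [← intervalIntegral.integral_add_adjacent_intervals (hi 0 s) (hi s (s + d)), mul_add]
  have h1 : (1 - Real.exp (-d)) * Ψ (valueIteration Ψ m s) =
      Real.exp (-(s + d)) * ∫ r in s..(s + d), Real.exp r * Ψ (valueIteration Ψ m s) := by
    rw [integral_exp_mul_const, ← mul_assoc, mul_sub, ← Real.exp_add, ← Real.exp_add]
    simp
  have h2 : Real.exp (-(s + d)) = Real.exp (-d) * Real.exp (-s) := by
    rw [← Real.exp_add]; ring_nf
  rw [h1, ← mul_assoc, ← h2]
  refine add_le_add_right (mul_le_mul_of_nonneg_left ?_ (Real.exp_pos _).le) _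
  refine intervalIntegral.integral_mono_on (by linarith)
    (Continuous.intervalIntegrable (by fun_prop) _ _) (hi _ _) fun r hr => ?_
  exact mul_le_mul_of_nonneg_left (hm (valueIteration_mono_time hc hm hΨ m hr.1))
    (Real.exp_pos r).le

/-- The values of the discrete stopping problem, in which only the first arrival in each interval of
length `d` is observed, are dominated by the limit of the value iteration. -/
lemma le_of_valueIteration_le (hc : Continuous Ψ) (hm : Monotone Ψ)
    (hΨ : ∀ v ∈ Set.Icc (0 : ℝ) 1, Ψ v ∈ Set.Icc (0 : ℝ) 1) {d : ℝ} (hd : 0 ≤ d) {v : ℕ → ℝ}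
    (hv0 : v 0 = 0)
    (hv : ∀ j, v (j + 1) = Real.exp (-d) * v j + (1 - Real.exp (-d)) * Ψ (v j)) (j : ℕ) {c : ℝ}
    (hcm : ∀ m, valueIteration Ψ m (j * d) ≤ c) : v j ≤ c := by
  -- The inequality of `valueIteration_add_ge` mixes the indices `m` and `m + 1`; passing to the
  -- limit in `m` removes the mismatch.
  have hlim : ∀ s, Tendsto (fun m => valueIteration Ψ m s) atTop
      (nhds (⨆ m, valueIteration Ψ m s)) := fun s =>
    tendsto_atTop_ciSup (valueIteration_mono_index hc hm hΨ s)
      ⟨1, by rintro _ ⟨m, rfl⟩; exact (valueIteration_mem_Icc hc hΨ m s).2⟩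
  refine le_trans ?_ (ciSup_le hcm)
  clear hcm
  induction j with
  | zero =>
    rw [hv0]
    exact ge_of_tendsto' (hlim _) fun m => (valueIteration_mem_Icc hc hΨ m _).1
  | succ j ih =>
    have hjd : 0 ≤ (j : ℝ) * d := by positivity
    have hexp : Real.exp (-d) ≤ 1 := Real.exp_le_one_iff.2 (by linarith)
    have h1 := ((hlim (j * d)).comp (tendsto_add_atTop_nat 1)).const_mul (Real.exp (-d))
    have h2 := ((hc.tendsto _).comp (hlim (j * d))).const_mul (1 - Real.exp (-d))
    have h3 := (hlim (j * d + d)).comp (tendsto_add_atTop_nat 1)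
    have h4 := le_of_tendsto_of_tendsto' (h1.add h2) h3 fun m =>
      valueIteration_add_ge hc hm hΨ m hjd hd
    have h5 : ((j + 1 : ℕ) : ℝ) * d = j * d + d := by push_cast; ring
    rw [h5, hv]
    refine le_trans ?_ h4
    exact add_le_add (mul_le_mul_of_nonneg_left ih (Real.exp_pos _).le)
      (mul_le_mul_of_nonneg_left (hm ih) (by linarith))

end valueIteration

/-! ### Threshold stopping rules -/

namespace IsMarkedPoisson

variable {X S : ℕ → Ω → ℝ} {μ : Measure ℝ} {P : Measure Ω} [IsProbabilityMeasure P]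
  [IsProbabilityMeasure μ]

/-- The observations `(x, y)` (mark, arrival time) accepted as the `i`-th of `m` arrivals before `t`
by the rule which compares the mark with the value of continuing. -/
def acceptSet (Ψ : ℝ → ℝ) (t : ℝ) (m i : ℕ) : Set (ℝ × ℝ) :=
  {z | valueIteration Ψ (m - 1 - i) (t - z.2) ≤ z.1}

lemma measurableSet_acceptSet {Ψ : ℝ → ℝ} (hc : Continuous Ψ) (t : ℝ) (m i : ℕ) :
    MeasurableSet (acceptSet Ψ t m i) := by
  have := (continuous_valueIteration hc (m - 1 - i)).measurable
  exact measurableSet_le (by fun_prop) (by fun_prop)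

/-- The optimality equation: the next arrival, if in time, is worth the larger of its mark and the
value of continuing. -/
lemma integral_observation_value {Ψ : ℝ → ℝ} (hc : Continuous Ψ)
    (hΨ : ∀ v, Ψ v = ∫ x, max x v ∂μ) (t r : ℝ) (m : ℕ) :
    ∫ u, ∫ x, (if r + u ≤ t then max x (valueIteration Ψ m (t - (r + u))) else 0) ∂μ
      ∂(expMeasure 1) = valueIteration Ψ (m + 1) (t - r) := by
  have hcm := continuous_valueIteration hc m
  have h1 : ∀ u, ∫ x, (if r + u ≤ t then max x (valueIteration Ψ m (t - (r + u))) else 0) ∂μ =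
      if u ≤ t - r then Ψ (valueIteration Ψ m (t - r - u)) else 0 := by
    intro u
    by_cases hu : r + u ≤ t
    · rw [if_pos (by linarith), hΨ]
      simp only [if_pos hu, sub_sub]
    · rw [if_neg (by linarith)]
      simp [if_neg hu]
  simp_rw [h1]
  rcases le_or_gt 0 (t - r) with hr | hr
  · rw [integral_expMeasure_one_ite (by fun_prop) 0 hr, valueIteration_succ_of_nonneg m hr]
    simp
  · rw [integral_expMeasure_one_ite_of_neg _ _ hr, valueIteration_of_nonpos _ hr.le]

open Classical in
/-- The expected payoff from the first `k` arrivals plus the expected value of continuing does not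
depend on `k`. -/
lemma sum_integral_accept_add (h : IsMarkedPoisson X S μ P) {Ψ : ℝ → ℝ} (hc : Continuous Ψ)
    (hΨ : ∀ v, Ψ v = ∫ x, max x v ∂μ)
    (hΨ1 : ∀ v ∈ Set.Icc (0 : ℝ) 1, Ψ v ∈ Set.Icc (0 : ℝ) 1) (t : ℝ) (m k : ℕ) (hk : k ≤ m) :
    ∑ i ∈ Finset.range k, ∫ ω, survival X S (acceptSet Ψ t m) i ω *
        (if (X i ω, S i ω) ∈ acceptSet Ψ t m i then payoff X S t i ω else 0) ∂P +
      ∫ ω, survival X S (acceptSet Ψ t m) k ω *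
        valueIteration Ψ (m - k) (t - prevArrival S k ω) ∂P = valueIteration Ψ m t := by
  have hB := fun i => measurableSet_acceptSet hc t m i
  induction k with
  | zero => simp [survival_zero, prevArrival_zero]
  | succ k ih =>
    rw [← ih (by omega), Finset.sum_range_succ, add_assoc]
    congr 1
    obtain ⟨l, hl⟩ : ∃ l, m - k = l + 1 := ⟨m - k - 1, by omega⟩
    have hl1 : m - (k + 1) = l := by omega
    have hl2 : m - 1 - k = l := by omega
    have hcl := continuous_valueIteration hc l
    set g : ℝ × ℝ → ℝ := fun z => if z.1 ≤ t then max z.2 (valueIteration Ψ l (t - z.1)) else 0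
      with hg
    have hgm : Measurable g := by
      have := hcl.measurable
      exact Measurable.ite (measurable_fst measurableSet_Iic) (by fun_prop) measurable_const
    have hgC : ∀ y, ∀ x ∈ Set.Icc (0 : ℝ) 1, |g (y, x)| ≤ 1 := by
      intro y x hx
      have hv := valueIteration_mem_Icc hc hΨ1 l (t - y)
      simp only [hg]
      split_ifs
      · rw [abs_of_nonneg (hx.1.trans (le_max_left _ _))]
        exact max_le hx.2 hv.2
      · simp
    have hone := h.integral_mul_observation k (measurable_survival hB k)
      (fun ω => abs_survival_le_one k ω) hgm hgC
    simp only [hg, integral_observation_value hc hΨ] at hone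
    rw [hl, hl1, ← hone]
    have hsm : ∀ i, Measurable (survival X S (acceptSet Ψ t m) i) := fun i =>
      (measurable_survival hB i).mono (h.priorSigma_le i) le_rfl
    rw [← integral_add]
    · congr 1 with ω
      rw [survival_succ, prevArrival_succ, mul_assoc, ← mul_add]
      congr 1
      simp only [acceptSet, Set.mem_ofPred_eq, hl2, payoff]
      by_cases hS : S k ω ≤ t
      · simp only [if_pos hS]
        split_ifs with hacc
        · simp [hacc]
        · rw [max_eq_right (not_le.1 hacc).le]; simp
      -- After time `t` the threshold is `0`: the arrival is accepted, with payoff `0`.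
      · rw [valueIteration_of_nonpos l (by linarith : t - S k ω ≤ 0)]
        simp [hS, (h.mark_mem k ω).1]
    · refine Integrable.of_bound ((hsm k).mul (Measurable.ite
        (((h.measurable_mark k).prodMk (h.measurable_arrival k)) (hB k)) (h.measurable_payoff t k)
        measurable_const)).aestronglyMeasurable 1 (ae_of_all _ fun ω => ?_)
      rw [Real.norm_eq_abs, abs_mul]
      refine mul_le_one₀ (abs_survival_le_one k ω) (abs_nonneg _) ?_
      have hp := h.payoff_mem_Icc t k ω
      split_ifs
      · rw [abs_of_nonneg hp.1]; exact hp.2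
      · simp
    · have hpm : Measurable (prevArrival S (k + 1)) :=
        (measurable_prevArrival X S (k + 1)).mono (h.priorSigma_le _) le_rfl
      refine Integrable.of_bound ((hsm (k + 1)).mul (hcl.measurable.comp
        (measurable_const.sub hpm))).aestronglyMeasurable 1 (ae_of_all _ fun ω => ?_)
      rw [Real.norm_eq_abs, abs_mul]
      have hv := valueIteration_mem_Icc hc hΨ1 l (t - prevArrival S (k + 1) ω)
      exact mul_le_one₀ (abs_survival_le_one _ ω) (abs_nonneg _)
        ((abs_of_nonneg hv.1).trans_le hv.2)

theorem exists_stoppingRule (h : IsMarkedPoisson X S μ P) {Ψ : ℝ → ℝ} (hc : Continuous Ψ)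
    (hΨ : ∀ v, Ψ v = ∫ x, max x v ∂μ)
    (hΨ1 : ∀ v ∈ Set.Icc (0 : ℝ) 1, Ψ v ∈ Set.Icc (0 : ℝ) 1) (t : ℝ) {m : ℕ} (hm : 0 < m) :
    ∃ τ : Ω → ℕ, IsStoppingRule X S τ ∧
      valueIteration Ψ m t = ∫ ω, payoff X S t (τ ω) ω ∂P := by
  classical
  have hB := fun i => measurableSet_acceptSet hc t m i
  -- With no further arrival considered the threshold is `0`, so the last of the `m` arrivals is
  -- always accepted and the rule is finite everywhere.
  have hlast : ∀ ω, (X (m - 1) ω, S (m - 1) ω) ∈ acceptSet Ψ t m (m - 1) := by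
    intro ω
    simp [acceptSet, valueIteration, (h.mark_mem (m - 1) ω).1]
  have hex : ∀ ω, ∃ i, (X i ω, S i ω) ∈ acceptSet Ψ t m i := fun ω => ⟨m - 1, hlast ω⟩
  set τ : Ω → ℕ := fun ω => Nat.find (hex ω) with hτ
  have hτm : ∀ ω, τ ω < m := fun ω =>
    (Nat.find_min' (hex ω) (hlast ω)).trans_lt (by omega)
  have hτi : ∀ i ω, τ ω = i ↔
      ω ∈ survivalSet X S (acceptSet Ψ t m) i ∧ (X i ω, S i ω) ∈ acceptSet Ψ t m i := by
    intro i ω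
    rw [hτ, Nat.find_eq_iff, and_comm]
    rfl
  refine ⟨τ, fun i => ?_, ?_⟩
  · have hset : {ω | τ ω = i} = survivalSet X S (acceptSet Ψ t m) i ∩
        (fun ω => (X i ω, S i ω)) ⁻¹' acceptSet Ψ t m i := Set.ext fun ω => hτi i ω
    rw [hset]
    exact (priorSigma_mono X S (Nat.le_succ i) _ (measurableSet_survivalSet hB i)).inter
      (measurable_observation X S (Nat.lt_succ_self i) (hB i))
  · have hsum := h.sum_integral_accept_add hc hΨ hΨ1 t m m le_rfl
    simp only [Nat.sub_self, valueIteration, mul_zero, integral_zero, add_zero] at hsum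
    rw [← hsum, ← integral_finsetSum]
    · congr 1 with ω
      rw [Finset.sum_eq_single_of_mem (τ ω) (Finset.mem_range.2 (hτm ω))]
      · obtain ⟨h1, h2⟩ := (hτi _ ω).1 rfl
        rw [if_pos h2, survival, Set.indicator_of_mem h1]
        simp
      · intro i _ hi
        have h1 := mt (hτi i ω).2 (Ne.symm hi)
        by_cases h2 : ω ∈ survivalSet X S (acceptSet Ψ t m) i
        · rw [if_neg fun h3 => h1 ⟨h2, h3⟩, mul_zero]
        · rw [survival, Set.indicator_of_notMem h2, zero_mul]
    · intro i _
      refine Integrable.of_bound (((measurable_survival hB i).mono (h.priorSigma_le i) le_rfl).mul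
        (Measurable.ite (((h.measurable_mark i).prodMk (h.measurable_arrival i)) (hB i))
        (h.measurable_payoff t i) measurable_const)).aestronglyMeasurable 1 (ae_of_all _ fun ω => ?_)
      rw [Real.norm_eq_abs, abs_mul]
      refine mul_le_one₀ (abs_survival_le_one i ω) (abs_nonneg _) ?_
      have hp := h.payoff_mem_Icc t i ω
      split_ifs
      · rw [abs_of_nonneg hp.1]; exact hp.2
      · simp

end IsMarkedPoisson

/-! ### The difference between the prophet and the optimal stopper -/

section expectedMax

variable {μ : Measure ℝ} [IsProbabilityMeasure μ]

lemma integrable_max_const (hμ : ∀ᵐ x ∂μ, x ∈ Set.Icc (0 : ℝ) 1) (v : ℝ) :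
    Integrable (fun x => max x v) μ := by
  refine Integrable.of_bound (by fun_prop) (1 + |v|) ?_
  filter_upwards [hμ] with x hx
  rw [Real.norm_eq_abs]
  refine (abs_max_le_max_abs_abs).trans (max_le ?_ ?_)
  · rw [abs_of_nonneg hx.1]; linarith [hx.2, abs_nonneg v]
  · linarith

lemma continuous_integral_max (hμ : ∀ᵐ x ∂μ, x ∈ Set.Icc (0 : ℝ) 1) :
    Continuous fun v => ∫ x, max x v ∂μ := by
  refine LipschitzWith.continuous (K := 1) (LipschitzWith.of_dist_le_mul fun v w => ?_)
  rw [Real.dist_eq, Real.dist_eq,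
    ← integral_sub (integrable_max_const hμ v) (integrable_max_const hμ w)]
  have h := norm_integral_le_of_norm_le_const (μ := μ) (f := fun x => max x v - max x w)
    (C := |v - w|) (ae_of_all _ fun x => by
      rw [Real.norm_eq_abs]
      simpa [max_comm] using abs_max_sub_max_le_abs v w x)
  simpa using h

lemma monotone_integral_max (hμ : ∀ᵐ x ∂μ, x ∈ Set.Icc (0 : ℝ) 1) :
    Monotone fun v => ∫ x, max x v ∂μ := fun v w hvw =>
  integral_mono (integrable_max_const hμ v) (integrable_max_const hμ w) fun _ =>
    max_le_max_left _ hvw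

lemma integral_max_mem_Icc (hμ : ∀ᵐ x ∂μ, x ∈ Set.Icc (0 : ℝ) 1) {v : ℝ}
    (hv : v ∈ Set.Icc (0 : ℝ) 1) : ∫ x, max x v ∂μ ∈ Set.Icc (0 : ℝ) 1 := by
  constructor
  · exact integral_nonneg fun x => hv.1.trans (le_max_right _ _)
  · have := integral_mono_ae (integrable_max_const hμ v) (integrable_const (1 : ℝ)) (by
      filter_upwards [hμ] with x hx using max_le hx.2 hv.2)
    simpa using this

lemma antitone_tail : Antitone fun x => μ.real (Set.Ioi x) :=
  fun _ _ hxy => measureReal_mono (Set.Ioi_subset_Ioi hxy)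

/-- The layer-cake formula for the excess over `v`. It identifies the recursion for `v` in
`hillKertz_inequality` with that in `le_of_valueIteration_le`. -/
lemma integral_max_eq (hμ : ∀ᵐ x ∂μ, x ∈ Set.Icc (0 : ℝ) 1) {v : ℝ} (hv : v ≤ 1) :
    ∫ x, max x v ∂μ = v + ∫ x in v..1, μ.real (Set.Ioi x) := by
  have hi : Integrable (fun x => max x v - v) μ :=
    (integrable_max_const hμ v).sub (integrable_const v)
  have h1 : ∫ x, max x v ∂μ = v + ∫ x, (max x v - v) ∂μ := by
    rw [integral_sub (integrable_max_const hμ v) (integrable_const v)]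
    simp
  rw [h1, hi.integral_eq_integral_meas_lt (ae_of_all _ fun x => sub_nonneg.2 (le_max_right _ _))]
  congr 1
  have h2 : ∀ y ∈ Set.Ioi (0 : ℝ), μ.real {x | y < max x v - v} = μ.real (Set.Ioi (v + y)) := by
    intro y hy
    congr 1
    ext x
    have hy' : 0 < y := hy
    simp only [Set.mem_ofPred_eq, Set.mem_Ioi, lt_sub_iff_add_lt, lt_max_iff, add_comm y v]
    exact ⟨fun h => h.resolve_right (by linarith), Or.inl⟩
  rw [setIntegral_congr_fun measurableSet_Ioi h2,
    setIntegral_eq_of_subset_of_forall_sdiff_eq_zero measurableSet_Ioi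
      (fun x hx => hx.1 : Set.Ioc (0 : ℝ) (1 - v) ⊆ Set.Ioi 0),
    ← intervalIntegral.integral_of_le (by linarith),
    intervalIntegral.integral_comp_add_left (fun x => μ.real (Set.Ioi x))]
  · simp
  · rintro y ⟨hy0, hy1⟩
    have hy : 1 < v + y := by
      by_contra! hy
      exact hy1 ⟨hy0, by linarith⟩
    have h3 : μ (Set.Ioi (v + y)) = 0 := by
      rw [measure_eq_zero_iff_ae_notMem]
      filter_upwards [hμ] with x hx
      exact not_lt.2 (hx.2.trans hy.le)
    rw [measureReal_def, h3, ENNReal.toReal_zero]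

end expectedMax

namespace IsMarkedPoisson

variable {X S : ℕ → Ω → ℝ} {μ : Measure ℝ} {P : Measure Ω} [IsProbabilityMeasure P]
  [IsProbabilityMeasure μ]

/-- Stated for any bound `c` on the payoffs of rules, so that `c` may be the value of a problem with
a larger supply of rules. -/
theorem prophetValue_sub_le (h : IsMarkedPoisson X S μ P) {t c : ℝ} (ht : 0 < t)
    (hc : ∀ τ, IsStoppingRule X S τ → ∫ ω, payoff X S t (τ ω) ω ∂P ≤ c) {n : ℕ} (hn : 2 ≤ n)
    {β : ℝ} (hβ : IsHillKertzBeta n β) :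
    prophetValue X S P t - c ≤
      β + (1 - Real.exp (-t)) * (1 - (n : ℝ) * (1 - Real.exp (-t / (n : ℝ))) / t) := by
  have hn0 : (0 : ℝ) < n := by positivity
  have hμ := h.law_mem
  set q := 1 - Real.exp (-t / n) with hq
  have hq0 : 0 ≤ q := by
    rw [hq, sub_nonneg, Real.exp_le_one_iff]
    exact div_nonpos_of_nonpos_of_nonneg (by linarith) hn0.le
  have hq1 : q ≤ 1 := by rw [hq]; linarith [Real.exp_pos (-t / n)]
  set G : ℝ → ℝ := fun x => q * μ.real (Set.Ioi x) with hGdef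
  have hG : Antitone G := fun x y hxy => mul_le_mul_of_nonneg_left (antitone_tail hxy) hq0
  have hG0 : ∀ x, 0 ≤ G x := fun x => mul_nonneg hq0 measureReal_nonneg
  have hG1 : ∀ x, G x ≤ 1 := fun x => mul_le_one₀ hq1 measureReal_nonneg measureReal_le_one
  set v : ℕ → ℝ := fun j => Nat.rec 0 (fun _ y => y + ∫ x in y..1, G x) j with hvdef
  have hv0 : v 0 = 0 := rfl
  have hv : ∀ j, v (j + 1) = v j + ∫ x in v j..1, G x := fun _ => rfl
  have hkertz := hillKertz_inequality hn hβ hG hG0 hG1 hv0 hv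
  set Ψ : ℝ → ℝ := fun v => ∫ x, max x v ∂μ with hΨdef
  have hΨc : Continuous Ψ := continuous_integral_max hμ
  have hΨ1 : ∀ v ∈ Set.Icc (0 : ℝ) 1, Ψ v ∈ Set.Icc (0 : ℝ) 1 := fun v hv =>
    integral_max_mem_Icc hμ hv
  have hΨm : Monotone Ψ := monotone_integral_max hμ
  have hvc : v n ≤ c := by
    refine le_of_valueIteration_le hΨc hΨm hΨ1 (d := t / n) (by positivity) hv0 (fun j => ?_) n
      fun m => ?_
    · have hvj := stopValue_mem_Icc hG hG0 hG1 hv0 hv j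
      rw [hv, hΨdef]
      simp only
      rw [integral_max_eq hμ hvj.2.2, ← neg_div, ← hq, intervalIntegral.integral_const_mul]
      ring
    · rw [mul_div_cancel₀ _ hn0.ne']
      -- A rule must stop at some arrival, so the horizon has to be positive.
      refine (valueIteration_mono_index hΨc hΨm hΨ1 t (Nat.le_succ m)).trans ?_
      obtain ⟨τ, hτ, hτv⟩ := h.exists_stoppingRule hΨc (fun _ => rfl) hΨ1 t (Nat.succ_pos m)
      exact hτv.trans_le (hc τ hτ)
  have hexp : Antitone fun x => 1 - Real.exp (-t * μ.real (Set.Ioi x)) := fun x y hxy =>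
    sub_le_sub_left (Real.exp_le_exp.2 (by
      have := antitone_tail (μ := μ) hxy
      simp only at this
      nlinarith)) 1
  have hpow := hG.intervalIntegrable_one_sub_pow hG1 n 0 1
  have hpow' : IntervalIntegrable (fun x => 1 - (1 - G x) ^ n) volume 0 1 :=
    IntervalIntegrable.sub (by simp) hpow
  set ε := (1 - Real.exp (-t)) * (1 - (n : ℝ) * q / t) with hε
  have hcomp : ∫ x in (0 : ℝ)..1, (1 - Real.exp (-t * μ.real (Set.Ioi x))) ≤
      (∫ x in (0 : ℝ)..1, (1 - (1 - G x) ^ n)) + ε := by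
    have h1 : ∫ x in (0 : ℝ)..1, ((1 - (1 - G x) ^ n) + ε) =
        (∫ x in (0 : ℝ)..1, (1 - (1 - G x) ^ n)) + ε := by
      rw [intervalIntegral.integral_add hpow' (by simp)]
      simp
    rw [← h1]
    refine intervalIntegral.integral_mono_on zero_le_one hexp.intervalIntegrable
      (hpow'.add (by simp)) fun x _ => ?_
    have h2 := one_sub_pow_sub_exp_le (show n ≠ 0 by omega) ht (p := μ.real (Set.Ioi x))
      measureReal_nonneg measureReal_le_one
    linarith
  have hM := h.prophetValue_le ht.le
  linarith

end IsMarkedPoisson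

/-- Truncation of a real number to `[0, 1]`. -/
def clampUnit (x : ℝ) : ℝ := max 0 (min 1 x)

lemma measurable_clampUnit : Measurable clampUnit :=
  measurable_const.max (measurable_const.min measurable_id)

lemma clampUnit_mem_Icc (x : ℝ) : clampUnit x ∈ Set.Icc (0 : ℝ) 1 :=
  ⟨le_max_left _ _, max_le zero_le_one (min_le_left _ _)⟩

lemma clampUnit_of_mem {x : ℝ} (hx : x ∈ Set.Icc (0 : ℝ) 1) : clampUnit x = x := by
  rw [clampUnit, min_eq_right hx.2, max_eq_right hx.1]

/-- The marks lie in `[0, 1]` only almost surely. Truncation makes this hold everywhere without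
changing either expectation, which keeps null sets out of the stopping rules. -/
lemma isMarkedPoisson_clampUnit {P : Measure Ω} [IsProbabilityMeasure P] {X S : ℕ → Ω → ℝ}
    (hX_meas : ∀ k, Measurable (X k)) (hX_indep : iIndepFun X P)
    (hX_ident : ∀ k, IdentDistrib (X k) (X 0) P P) (hS : IsUnitPoissonArrivals S P)
    (hXS : IndepFun (fun ω k => X k ω) (fun ω k => S k ω) P) :
    IsMarkedPoisson (fun k ω => clampUnit (X k ω)) S (P.map fun ω => clampUnit (X 0 ω)) P := by
  have hcX : ∀ k, Measurable fun ω => clampUnit (X k ω) := fun k =>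
    measurable_clampUnit.comp (hX_meas k)
  have hT : ∀ k, Measurable (interarrival S k) := by
    intro k
    cases k with
    | zero => exact hS.measurable 0
    | succ k => exact (hS.measurable (k + 1)).sub (hS.measurable k)
  have hXT : IndepFun (fun ω k => clampUnit (X k ω)) (fun ω k => interarrival S k ω) P := by
    refine hXS.comp (φ := fun x k => clampUnit (x k))
      (ψ := fun s k => Nat.casesOn k (s 0) fun k => s (k + 1) - s k) ?_ ?_ |>.congr
      (ae_of_all _ fun ω => rfl) (ae_of_all _ fun ω => ?_)
    · exact measurable_pi_lambda _ fun k => measurable_clampUnit.comp (measurable_pi_apply k)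
    · refine measurable_pi_lambda _ fun k => ?_
      cases k with
      | zero => exact measurable_pi_apply 0
      | succ k => exact (measurable_pi_apply (k + 1)).sub (measurable_pi_apply k)
    · funext k
      cases k <;> rfl
  refine ⟨hcX, hS.measurable, fun k ω => clampUnit_mem_Icc _, ?_, ?_, fun k => ?_⟩
  · exact (ae_map_iff (hcX 0).aemeasurable measurableSet_Icc).2
      (ae_of_all _ fun ω => clampUnit_mem_Icc _)
  · exact iIndepFun_prodMk_of_indepFun hcX hT
      (hX_indep.comp (fun _ => clampUnit) fun _ => measurable_clampUnit) hS.indep hXT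
  · have hk : IndepFun (interarrival S k) (fun ω => clampUnit (X k ω)) P :=
      (hXT.comp (measurable_pi_apply k) (measurable_pi_apply k)).symm
    rw [hk.map_prod_eq_prod_map_map (hT k).aemeasurable (hcX k).aemeasurable, hS.law k]
    congr 1
    exact ((hX_ident k).comp measurable_clampUnit).map_eq

end MarkedPoisson

/-- The first conjunct certifies that the choice made in `hillKertzB` is the unique root. -/
theorem mainTheorem2 {Ω : Type*} [MeasurableSpace Ω] (P : Measure Ω) [IsProbabilityMeasure P]
    (X S : ℕ → Ω → ℝ)
    (hX_meas : ∀ k, Measurable (X k))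
    (hX_indep : iIndepFun X P)
    (hX_ident : ∀ k, IdentDistrib (X k) (X 0) P P)
    (hX_range : ∀ k, ∀ᵐ ω ∂P, X k ω ∈ Set.Icc (0 : ℝ) 1)
    (hS : IsUnitPoissonArrivals S P)
    (hXS : IndepFun (fun ω k => X k ω) (fun ω k => S k ω) P) :
    (∀ n : ℕ, 2 ≤ n → IsHillKertzBeta n (hillKertzB n) ∧
      ∀ β : ℝ, IsHillKertzBeta n β → β = hillKertzB n) ∧
    ∀ t : ℝ, 0 < t →
      prophetValue X S P t - stoppingValue X S P t ≤ limsup hillKertzB atTop ∧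
      ∀ n : ℕ, 2 ≤ n →
        prophetValue X S P t - stoppingValue X S P t ≤
          hillKertzB n + (1 - Real.exp (-t)) *
            (1 - (n : ℝ) * (1 - Real.exp (-t / (n : ℝ))) / t) := by
  refine ⟨fun n hn => ⟨isHillKertzBeta_hillKertzB hn, fun β hβ =>
    isHillKertzBeta_unique hn hβ (isHillKertzBeta_hillKertzB hn)⟩, fun t ht => ?_⟩
  have hbound : ∀ n : ℕ, 2 ≤ n → prophetValue X S P t - stoppingValue X S P t ≤
      hillKertzB n + (1 - Real.exp (-t)) *
        (1 - (n : ℝ) * (1 - Real.exp (-t / (n : ℝ))) / t) := by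
    have h := isMarkedPoisson_clampUnit hX_meas hX_indep hX_ident hS hXS
    have : IsProbabilityMeasure (P.map fun ω => clampUnit (X 0 ω)) :=
      Measure.isProbabilityMeasure_map (measurable_clampUnit.comp (hX_meas 0)).aemeasurable
    have hae : ∀ᵐ ω ∂P, ∀ k, payoff (fun k ω => clampUnit (X k ω)) S t k ω = payoff X S t k ω := by
      filter_upwards [ae_all_iff.2 hX_range] with ω hω k
      simp only [payoff, clampUnit_of_mem (hω k)]
    have hM : prophetValue (fun k ω => clampUnit (X k ω)) S P t = prophetValue X S P t := by
      refine integral_congr_ae ?_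
      filter_upwards [hae] with ω hω
      simp only [hω]
    have hint : ∀ τ : Ω → ℕ, ∫ ω, payoff (fun k ω => clampUnit (X k ω)) S t (τ ω) ω ∂P =
        ∫ ω, payoff X S t (τ ω) ω ∂P := by
      intro τ
      refine integral_congr_ae ?_
      filter_upwards [hae] with ω hω using hω _
    intro n hn
    rw [← hM]
    refine h.prophetValue_sub_le ht (fun τ hτ => ?_) hn (isHillKertzBeta_hillKertzB hn)
    refine le_csSup ⟨1, ?_⟩ ⟨τ, fun i => ?_, hint τ⟩
    · rintro _ ⟨σ, -, rfl⟩
      rw [← hint σ]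
      have h1 := integral_mono_of_nonneg (μ := P)
        (ae_of_all _ fun ω => (h.payoff_mem_Icc t (σ ω) ω).1) (integrable_const (1 : ℝ))
        (ae_of_all _ fun ω => (h.payoff_mem_Icc t (σ ω) ω).2)
      simpa using h1
    -- Truncated marks are functions of the original ones, so every rule for them is a rule for the
    -- original sequence.
    · have hle : observedSigma (fun k ω => clampUnit (X k ω)) S i ≤ observedSigma X S i := by
        refine iSup₂_le fun j hj => Measurable.comap_le ?_
        have hj' := measurable_observation X S (Finset.mem_range.1 hj)
        exact (measurable_clampUnit.comp (measurable_fst.comp hj')).prodMk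
          (measurable_snd.comp hj')
      exact hle _ (hτ i)
  refine ⟨le_of_forall_pos_le_add fun ε hε => ?_, hbound⟩
  rw [← sub_le_iff_le_add]
  have hev : ∀ᶠ n : ℕ in atTop, 2 ≤ n := eventually_ge_atTop 2
  refine le_limsup_of_frequently_le (Eventually.frequently ?_) ?_
  -- With `x = t/n`, `e^(-x) ≤ 1/(1 + x)` gives `1 - e^(-x) ≥ x (1 - x)`, so the error term is at
  -- most `t/n ≤ ε`.
  · filter_upwards [hev, eventually_ge_atTop ⌈t / ε⌉₊] with n hn hnt
    have hn0 : (0 : ℝ) < n := by positivity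
    have hnt' : t / n ≤ ε := by
      have := (div_le_iff₀ hε).1 (Nat.ceil_le.1 hnt)
      rw [div_le_iff₀ hn0]
      linarith
    have hx : 0 < t / n := by positivity
    have h1 : Real.exp (-t / n) ≤ 1 / (1 + t / n) := by
      rw [neg_div, Real.exp_neg, one_div]
      exact inv_anti₀ (by positivity) (by linarith [Real.add_one_le_exp (t / n)])
    have h2 : 1 - t / n ≤ (n : ℝ) * (1 - Real.exp (-t / n)) / t := by
      have h3 : 1 - 1 / (1 + t / n) = t / n * (1 / (1 + t / n)) := by field_simp; ring
      have h4 : t / n * (1 - t / n) ≤ 1 - Real.exp (-t / n) := by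
        have h5 : 1 - t / n ≤ 1 / (1 + t / n) := by
          rw [le_div_iff₀ (by positivity)]; nlinarith
        nlinarith
      rw [le_div_iff₀ ht]
      have h6 := mul_le_mul_of_nonneg_left h4 hn0.le
      have h7 : (n : ℝ) * (t / n * (1 - t / n)) = (1 - t / n) * t := by field_simp
      linarith
    have h8 : 0 ≤ 1 - Real.exp (-t) := by
      rw [sub_nonneg, Real.exp_le_one_iff]; linarith
    have h9 : (1 - Real.exp (-t)) * (1 - (n : ℝ) * (1 - Real.exp (-t / n)) / t) ≤ ε :=
      calc _ ≤ (1 - Real.exp (-t)) * (t / n) := mul_le_mul_of_nonneg_left (by linarith) h8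
        _ ≤ 1 * (t / n) :=
          mul_le_mul_of_nonneg_right (by linarith [Real.exp_pos (-t)]) hx.le
        _ ≤ ε := by linarith
    have := hbound n hn
    linarith
  -- A real `limsup` is meaningful only for a bounded sequence; here `b_n < 1`.
  · refine ⟨1, ?_⟩
    rw [eventually_map]
    filter_upwards [hev] with n hn
    exact (isHillKertzBeta_hillKertzB hn).1.2.le
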